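/- **Setting.** All manifolds, Lie groups and maps are smooth and finite-dimensional. $H$ and $D$ are Lie groups and $H$ is a crossed $D$-module: there are a smooth homomorphism $\alpha:H\to D$ and a smooth action $(d,h)\mapsto {}^dh$ of $D$ on $H$ by automorphisms, with ${}^{\alpha(h)}h'=hh'h^{-1}$ and $\alpha({}^dh)=d\,\alpha(h)\,d^{-1}$. An *$H$-bibundle* $E$ is a bundle that is both a left and a right principal $H$-bundle, with commuting actions; $\varphi_e\in \mathrm{Aut}(H)$ is defined by $\varphi_e(h)\,e=e\triangleleft h$. The *inverse* $E^{-1}$ has the same total space and the actions $h\,e^{-1}=(e\triangleleft h^{-1})^{-1}$, $e^{-1}\triangleleft h=(h^{-1}e)^{-1}$. A *$D$-$H$ bundle* over a manifold $B$ is a left principal $D$-bundle $Q\to B$ with a global section of $\mathrm{Aut}(H)\times_DQ$, i.e. with a smooth map $\psi:Q\to \mathrm{Aut}(H)$ such that $\psi_{dq}(h)={}^d\psi_q(h)$; it has the right $H$-action $q\triangleleft h=\alpha(\psi_q(h))\,q$. Morphisms of $D$-$H$ bundles over $B$ are the smooth $D$-equivariant maps over $\mathrm{id}_B$ that preserve $\psi$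 (they are isomorphisms). The *product* of a bibundle or $D$-$H$ bundle $Q$ with a bibundle $E$ over the same base is the quotient $QE$ of the fibre product by $(q\triangleleft h,e)\sim(q,he)$, with the left action inherited from $Q$; it is a bibundle with $[q,e]\triangleleft h=[q,e\triangleleft h]$ or, respectively, a $D$-$H$ bundle with $\psi_{[q,e]}=\psi_q\circ\varphi_e$. Let $\wp:Y\to M$ be a surjective submersion and $Y^{[k]}$ the $k$-fold fibre product of $Y$ over $M$; indices denote pull-backs along the projections. An *$H$-bundle gerbe* $(\mathcal E,Y,M,\mathbf f)$ is an $H$-bibundle $\mathcal E\to Y^{[2]}$ with an isomorphism of bibundles $f:\mathcal E_{12}\mathcal E_{23}\to\mathcal E_{13}$ over $Y^{[3]}$ (equivalently, a global central section $\mathbf f$ of $(\mathcal E_{12}\mathcal E_{23}\mathcal E_{13}^{-1})^{-1}$) that is associative over $Y^{[4]}$. It is *trivial* if it has a trivialization: an $H$-bibundle $\mathcal N\to Y$ and an isomorphism of bibundles $\beta:\mathcal N_1^{-1}\mathcal N_2\to\mathcal E$ over $Y^{[2]}$ that carries the canonical contraction $\mathcal N_1^{-1}\mathcal N_2\mathcal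 N_2^{-1}\mathcal N_3\to\mathcal N_1^{-1}\mathcal N_3$ to $f$. An *$\mathcal E$-module* is a $D$-$H$ bundle $\mathcal Q\to Y$ with an isomorphism of $D$-$H$ bundles $z:\mathcal Q_1\mathcal E\to\mathcal Q_2$ over $Y^{[2]}$ such that $z_{23}\circ(z_{12}\,\mathrm{id})=z_{13}\circ(\mathrm{id}\,f)$ as maps $\mathcal Q_1\mathcal E_{12}\mathcal E_{23}\to\mathcal Q_3$ over $Y^{[3]}$. Morphisms of $\mathcal E$-modules are the morphisms of $D$-$H$ bundles over $Y$ that commute with $z$. **Proposition.** Let $(\mathcal E,Y,M,\mathbf f)$ be a trivial $H$-bundle gerbe with a trivialization $(\mathcal N,\beta)$. Then there is an equivalence between the category of $\mathcal E$-modules and the category of $D$-$H$ bundles over $M$, consisting of quasi-inverse functors $F$ and $G$ of the following form. 1. $F$ sends a module $(\mathcal Q,z)$ to the $D$-$H$ bundle over $M$ obtained from $\mathcal Q\mathcal N^{-1}$ by descent along $\wp$: there is an isomorphism of $D$-$H$ bundles $\delta:\mathcal Q\mathcal N^{-1}\to\wp^*F(\mathcal Q,z)$ over $Y$, natural in the module,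 that carries the descent isomorphism $\mathcal Q_1\mathcal N_1^{-1}\to\mathcal Q_2\mathcal N_2^{-1}$, $[q,n^{-1}]\mapsto[z([q,\beta([n^{-1},n'])]),n'^{-1}]$, to the canonical one of $\wp^*F(\mathcal Q,z)$. 2. $G$ sends a $D$-$H$ bundle $\widetilde Q\to M$ to $\wp^*(\widetilde Q)\,\mathcal N$ with the module structure $[[p,n],\beta([n^{-1},n'])]\mapsto[p,n']$: there is an isomorphism of modules $\varepsilon$ from it to $G(\widetilde Q)$, natural in $\widetilde Q$. -/

import Mathlib

open scoped Manifold ContDiff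
open CategoryTheory

universe u

section Definitions

variable {EB HB : Type*} [NormedAddCommGroup EB] [NormedSpace ℝ EB] [TopologicalSpace HB]
  {B : Type u} [TopologicalSpace B] [ChartedSpace HB B]

/-- `P`, with the projection `proj` and the map `act : G → P → P`, is a smooth (left) principal
`G`-bundle over the embedded submanifold `S` of the manifold `B` (`S = Set.univ` for a bundle over
`B` itself; the fibre product `Y ×_M Y` is treated as a submanifold of `Y × Y`).
`ContMDiffOn` on a subset that is an embedded submanifold means smoothness as a map on that
submanifold.  Local triviality: over a neighbourhood `U` of each point of `S` there are a smooth
section `s` and a smooth `G`-equivariant map `χ` with `p = χ p • s (proj p)`, so that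
`p ↦ (proj p, χ p)` is an equivariant diffeomorphism from the part of `P` over `U` onto
`(U ∩ S) × G`, with inverse `(b, g) ↦ g • s b`. -/
structure IsPrincipalBundle (I : ModelWithCorners ℝ EB HB) (S : Set B)
    {VG : Type*} [NormedAddCommGroup VG] [NormedSpace ℝ VG]
    {HG : Type*} [TopologicalSpace HG] (IG : ModelWithCorners ℝ VG HG)
    {G : Type u} [Group G] [TopologicalSpace G] [ChartedSpace HG G]
    {VP : Type*} [NormedAddCommGroup VP] [NormedSpace ℝ VP]
    {HP : Type*} [TopologicalSpace HP] (IP : ModelWithCorners ℝ VP HP)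
    {P : Type u} [TopologicalSpace P] [ChartedSpace HP P]
    (proj : P → B) (act : G → P → P) : Prop where
  one_act : ∀ p, act 1 p = p
  mul_act : ∀ g g' p, act (g * g') p = act g (act g' p)
  smooth_act : ContMDiff (IG.prod IP) IP ∞ (fun x : G × P => act x.1 x.2)
  smooth_proj : ContMDiff IP I ∞ proj
  proj_mem : ∀ p, proj p ∈ S
  proj_act : ∀ g p, proj (act g p) = proj p
  locally_trivial : ∀ b ∈ S, ∃ U : Set B, IsOpen U ∧ b ∈ U ∧ ∃ (s : B → P) (χ : P → G),
    ContMDiffOn I IP ∞ s (U ∩ S) ∧ (∀ x ∈ U ∩ S, proj (s x) = x) ∧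
    ContMDiffOn IP IG ∞ χ (proj ⁻¹' U) ∧
    (∀ p ∈ proj ⁻¹' U, act (χ p) (s (proj p)) = p) ∧
    (∀ p ∈ proj ⁻¹' U, ∀ g, χ (act g p) = g * χ p)

/-- A principal `H`-bibundle over the embedded submanifold `S` of `B`: a smooth manifold that is
both a left and a right principal `H`-bundle, with commuting actions.  Right principality is
left principality of the left action `h • e := e ◁ h⁻¹`. -/
structure Bibundle (I : ModelWithCorners ℝ EB HB) (S : Set B)
    (VH : Type*) [NormedAddCommGroup VH] [NormedSpace ℝ VH]
    (H : Type u) [Group H] [TopologicalSpace H] [ChartedSpace VH H]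
    (VE : Type*) [NormedAddCommGroup VE] [NormedSpace ℝ VE] where
  carrier : Type u
  [top : TopologicalSpace carrier]
  [charted : ChartedSpace VE carrier]
  [mfd : IsManifold 𝓘(ℝ, VE) ∞ carrier]
  proj : carrier → B
  /-- the left action `(h, e) ↦ h e` -/
  lact : H → carrier → carrier
  /-- the right action `(e, h) ↦ e ◁ h` -/
  ract : carrier → H → carrier
  isLeft : IsPrincipalBundle I S 𝓘(ℝ, VH) 𝓘(ℝ, VE) proj lact
  isRight : IsPrincipalBundle I S 𝓘(ℝ, VH) 𝓘(ℝ, VE) proj (fun h e => ract e h⁻¹)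
  comm : ∀ k e h, ract (lact k e) h = lact k (ract e h)

attribute [instance] Bibundle.top Bibundle.charted Bibundle.mfd

namespace Bibundle

variable {I : ModelWithCorners ℝ EB HB} {S : Set B}
    {VH : Type*} [NormedAddCommGroup VH] [NormedSpace ℝ VH]
    {H : Type u} [Group H] [TopologicalSpace H] [ChartedSpace VH H]
    {VE : Type*} [NormedAddCommGroup VE] [NormedSpace ℝ VE]

theorem exists_phi (E : Bibundle I S VH H VE) (e : E.carrier) (h : H) :
    ∃ k : H, E.lact k e = E.ract e h := by
  have hp : E.proj (E.ract e h) = E.proj e := by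
    have := E.isRight.proj_act h⁻¹ e
    simpa using this
  obtain ⟨U, -, hb, s, χ, -, -, -, h1, -⟩ := E.isLeft.locally_trivial _ (E.isLeft.proj_mem e)
  have he := h1 e hb
  have he' := h1 (E.ract e h) (by show E.proj _ ∈ U; rw [hp]; exact hb)
  rw [hp] at he'
  refine ⟨χ (E.ract e h) * (χ e)⁻¹, ?_⟩
  calc E.lact (χ (E.ract e h) * (χ e)⁻¹) e
      = E.lact (χ (E.ract e h) * (χ e)⁻¹) (E.lact (χ e) (s (E.proj e))) := by rw [he]
    _ = E.lact (χ (E.ract e h)) (s (E.proj e)) := by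
        rw [← E.isLeft.mul_act]; simp
    _ = E.ract e h := he'

/-- The map `φ : E × H → H`, determined by `φ_e(h) e = e ◁ h`. -/
noncomputable def phi (E : Bibundle I S VH H VE) (e : E.carrier) (h : H) : H :=
  (E.exists_phi e h).choose

theorem phi_spec (E : Bibundle I S VH H VE) (e : E.carrier) (h : H) :
    E.lact (E.phi e h) e = E.ract e h :=
  (E.exists_phi e h).choose_spec

/-- The inverse bibundle: same total space, with
`h e⁻¹ = (e ◁ h⁻¹)⁻¹` and `e⁻¹ ◁ h = (h⁻¹ e)⁻¹`. -/
def inv (E : Bibundle I S VH H VE) : Bibundle I S VH H VE where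
  carrier := E.carrier
  proj := E.proj
  lact := fun h e => E.ract e h⁻¹
  ract := fun e h => E.lact h⁻¹ e
  isLeft := E.isRight
  isRight := by simpa using E.isLeft
  comm := fun k e h => (E.comm h⁻¹ e k⁻¹).symm

end Bibundle

/-- Let `A₁`, `A₂`, `C` be bibundles over (submanifolds of) `B₁`, `B₂`, `B₃`, let `r` be a relation
between points of `B₁` and `B₂`, cutting out a base space
`R = {(b₁, b₂) | b₁ ∈ S₁, b₂ ∈ S₂, r b₁ b₂}`, and let `c : R → B₃`.  The map `m`, which is defined
on pairs `(a₁, a₂)` lying over `R` (its other values are irrelevant), induces an isomorphism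
`[a₁, a₂] ↦ m a₁ a₂` of bibundles over `R` from the product of the pull-backs of `A₁` and `A₂`
to the pull-back of `C` along `c`: it is smooth on the fibre product, covers `c`, respects the
relation `(a₁ ◁ h, a₂) ∼ (a₁, h a₂)` that defines the product, and is left and right equivariant. -/
structure IsBibundleProduct
    {E₁ H₁ : Type*} [NormedAddCommGroup E₁] [NormedSpace ℝ E₁] [TopologicalSpace H₁]
    {B₁ : Type u} [TopologicalSpace B₁] [ChartedSpace H₁ B₁]
    {E₂ H₂ : Type*} [NormedAddCommGroup E₂] [NormedSpace ℝ E₂] [TopologicalSpace H₂]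
    {B₂ : Type u} [TopologicalSpace B₂] [ChartedSpace H₂ B₂]
    {E₃ H₃ : Type*} [NormedAddCommGroup E₃] [NormedSpace ℝ E₃] [TopologicalSpace H₃]
    {B₃ : Type u} [TopologicalSpace B₃] [ChartedSpace H₃ B₃]
    {I₁ : ModelWithCorners ℝ E₁ H₁} {I₂ : ModelWithCorners ℝ E₂ H₂}
    {I₃ : ModelWithCorners ℝ E₃ H₃}
    {S₁ : Set B₁} {S₂ : Set B₂} {S₃ : Set B₃}
    {VH : Type*} [NormedAddCommGroup VH] [NormedSpace ℝ VH]
    {H : Type u} [Group H] [TopologicalSpace H] [ChartedSpace VH H]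
    {V₁ : Type*} [NormedAddCommGroup V₁] [NormedSpace ℝ V₁]
    {V₂ : Type*} [NormedAddCommGroup V₂] [NormedSpace ℝ V₂]
    {V₃ : Type*} [NormedAddCommGroup V₃] [NormedSpace ℝ V₃]
    (r : B₁ → B₂ → Prop) (c : B₁ → B₂ → B₃)
    (A₁ : Bibundle I₁ S₁ VH H V₁) (A₂ : Bibundle I₂ S₂ VH H V₂) (C : Bibundle I₃ S₃ VH H V₃)
    (m : A₁.carrier → A₂.carrier → C.carrier) : Prop where
  smooth : ContMDiffOn (𝓘(ℝ, V₁).prod 𝓘(ℝ, V₂)) 𝓘(ℝ, V₃) ∞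
    (fun x : A₁.carrier × A₂.carrier => m x.1 x.2) {x | r (A₁.proj x.1) (A₂.proj x.2)}
  proj_eq : ∀ a a', r (A₁.proj a) (A₂.proj a') → C.proj (m a a') = c (A₁.proj a) (A₂.proj a')
  balanced : ∀ a a' h, r (A₁.proj a) (A₂.proj a') → m (A₁.ract a h) a' = m a (A₂.lact h a')
  left : ∀ h a a', r (A₁.proj a) (A₂.proj a') → m (A₁.lact h a) a' = C.lact h (m a a')
  right : ∀ a a' h, r (A₁.proj a) (A₂.proj a') → m a (A₂.ract a' h) = C.ract (m a a') h

end Definitions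

section CrossedModules

variable (VH : Type*) [NormedAddCommGroup VH] [NormedSpace ℝ VH]
  (VD : Type*) [NormedAddCommGroup VD] [NormedSpace ℝ VD]
  (H : Type u) [Group H] [TopologicalSpace H] [ChartedSpace VH H]
  (D : Type u) [Group D] [TopologicalSpace D] [ChartedSpace VD D]

/-- The structure of a crossed `D`-module on `H`, for Lie groups `H` and `D`; `act d h` is `ᵈh`. -/
structure LieCrossedModule where
  α : H →* D
  act : D →* MulAut H
  smooth_α : ContMDiff 𝓘(ℝ, VH) 𝓘(ℝ, VD) ∞ α
  smooth_act : ContMDiff (𝓘(ℝ, VD).prod 𝓘(ℝ, VH)) 𝓘(ℝ, VH) ∞ (fun x : D × H => act x.1 x.2)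
  act_α : ∀ h h', act (α h) h' = h * h' * h⁻¹
  α_act : ∀ d h, α (act d h) = d * α h * d⁻¹

end CrossedModules

section DHBundles

variable {VH : Type*} [NormedAddCommGroup VH] [NormedSpace ℝ VH]
  {VD : Type*} [NormedAddCommGroup VD] [NormedSpace ℝ VD]
  {H : Type u} [Group H] [TopologicalSpace H] [ChartedSpace VH H]
  {D : Type u} [Group D] [TopologicalSpace D] [ChartedSpace VD D]

/-- A `D`-`H` bundle over the manifold `B`: a left principal `D`-bundle `Q` (modelled, as it is
locally `U × D`, on the product of the models of `B` and `D`) with a global section `σ` of the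
bundle `Aut(H) ×_D Q`.  The section is given by the `D`-equivariant map `ψ : Q → Aut(H)`,
`ψ_q = σ̄([id, q])`.  Smoothness of `ψ` means that `ψ_q(h)` and `ψ_q⁻¹(h)` are jointly smooth. -/
structure DHBundle (X : LieCrossedModule VH VD H D)
    (VB : Type*) [NormedAddCommGroup VB] [NormedSpace ℝ VB]
    (B : Type u) [TopologicalSpace B] [ChartedSpace VB B] where
  carrier : Type u
  [top : TopologicalSpace carrier]
  [charted : ChartedSpace (ModelProd VB VD) carrier]
  [mfd : IsManifold (𝓘(ℝ, VB).prod 𝓘(ℝ, VD)) ∞ carrier]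
  proj : carrier → B
  act : D → carrier → carrier
  isPrincipal : IsPrincipalBundle 𝓘(ℝ, VB) Set.univ 𝓘(ℝ, VD) (𝓘(ℝ, VB).prod 𝓘(ℝ, VD)) proj act
  ψ : carrier → MulAut H
  smooth_ψ : ContMDiff ((𝓘(ℝ, VB).prod 𝓘(ℝ, VD)).prod 𝓘(ℝ, VH)) 𝓘(ℝ, VH) ∞
    (fun x : carrier × H => ψ x.1 x.2)
  smooth_ψ_symm : ContMDiff ((𝓘(ℝ, VB).prod 𝓘(ℝ, VD)).prod 𝓘(ℝ, VH)) 𝓘(ℝ, VH) ∞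
    (fun x : carrier × H => (ψ x.1).symm x.2)
  ψ_act : ∀ d q, ψ (act d q) = X.act d * ψ q

attribute [instance] DHBundle.top DHBundle.charted DHBundle.mfd

namespace DHBundle

variable {X : LieCrossedModule VH VD H D}
  {VB : Type*} [NormedAddCommGroup VB] [NormedSpace ℝ VB]
  {B : Type u} [TopologicalSpace B] [ChartedSpace VB B]

/-- The right action of `H` on a `D`-`H` bundle: `q ◁ h = ξ_q(h) q` with `ξ_q = α ∘ ψ_q`. -/
def ract (Q : DHBundle X VB B) (q : Q.carrier) (h : H) : Q.carrier :=
  Q.act (X.α (Q.ψ q h)) q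

/-- A morphism of `D`-`H` bundles over `B`: a smooth `D`-equivariant map over the identity of `B`
that intertwines the two sections.  (Such a map is automatically an isomorphism.) -/
@[ext]
structure Hom (Q Q' : DHBundle X VB B) where
  toFun : Q.carrier → Q'.carrier
  smooth : ContMDiff (𝓘(ℝ, VB).prod 𝓘(ℝ, VD)) (𝓘(ℝ, VB).prod 𝓘(ℝ, VD)) ∞ toFun
  proj_eq : ∀ q, Q'.proj (toFun q) = Q.proj q
  map_act : ∀ d q, toFun (Q.act d q) = Q'.act d (toFun q)
  ψ_eq : ∀ q, Q'.ψ (toFun q) = Q.ψ q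

instance : Category (DHBundle X VB B) where
  Hom := Hom
  id Q := ⟨id, contMDiff_id, fun _ => rfl, fun _ _ => rfl, fun _ => rfl⟩
  comp f g := ⟨g.toFun ∘ f.toFun, g.smooth.comp f.smooth,
    fun q => by simp [g.proj_eq, f.proj_eq], fun d q => by simp [g.map_act, f.map_act],
    fun q => by simp [g.ψ_eq, f.ψ_eq]⟩

end DHBundle

/-- Let `Q` and `C` be `D`-`H` bundles over `B₁` and `B₃`, and `A` an `H`-bibundle over (a
submanifold of) `B₂`; let `r`, `R` and `c` be as for `IsBibundleProduct`.  The map `m`, defined on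
pairs `(q, a)` lying over `R`, induces an isomorphism `[q, a] ↦ m q a` of `D`-`H` bundles over `R`
from the product of the pull-backs of `Q` and `A` to the pull-back of `C` along `c`.
The product is the quotient of the fibre product by `(q ◁ h, a) ∼ (q, h a)`, with
`d [q, a] = [d q, a]` and `ψ_[q, a] = ψ_q ∘ φ_a`. -/
structure IsDHProduct {X : LieCrossedModule VH VD H D}
    {V₁ : Type*} [NormedAddCommGroup V₁] [NormedSpace ℝ V₁]
    {B₁ : Type u} [TopologicalSpace B₁] [ChartedSpace V₁ B₁]
    {E₂ H₂ : Type*} [NormedAddCommGroup E₂] [NormedSpace ℝ E₂] [TopologicalSpace H₂]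
    {B₂ : Type u} [TopologicalSpace B₂] [ChartedSpace H₂ B₂]
    {I₂ : ModelWithCorners ℝ E₂ H₂} {S₂ : Set B₂}
    {VA : Type*} [NormedAddCommGroup VA] [NormedSpace ℝ VA]
    {V₃ : Type*} [NormedAddCommGroup V₃] [NormedSpace ℝ V₃]
    {B₃ : Type u} [TopologicalSpace B₃] [ChartedSpace V₃ B₃]
    (r : B₁ → B₂ → Prop) (c : B₁ → B₂ → B₃)
    (Q : DHBundle X V₁ B₁) (A : Bibundle I₂ S₂ VH H VA) (C : DHBundle X V₃ B₃)
    (m : Q.carrier → A.carrier → C.carrier) : Prop where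
  smooth : ContMDiffOn ((𝓘(ℝ, V₁).prod 𝓘(ℝ, VD)).prod 𝓘(ℝ, VA)) (𝓘(ℝ, V₃).prod 𝓘(ℝ, VD)) ∞
    (fun x : Q.carrier × A.carrier => m x.1 x.2) {x | r (Q.proj x.1) (A.proj x.2)}
  proj_eq : ∀ q a, r (Q.proj q) (A.proj a) → C.proj (m q a) = c (Q.proj q) (A.proj a)
  balanced : ∀ q a h, r (Q.proj q) (A.proj a) → m (Q.ract q h) a = m q (A.lact h a)
  map_act : ∀ d q a, r (Q.proj q) (A.proj a) → m (Q.act d q) a = C.act d (m q a)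
  ψ_eq : ∀ q a h, r (Q.proj q) (A.proj a) → C.ψ (m q a) h = Q.ψ q (A.phi a h)

end DHBundles

section Gerbes

variable {M : Type u} {Y : Type u} [TopologicalSpace Y]

/-- An `H`-bundle gerbe `(𝓔, Y, M, f)` relative to `℘ : Y → M`: an `H`-bibundle `𝓔` over
`Y^[2] = Y ×_M Y` and an isomorphism `f : 𝓔₁₂ 𝓔₂₃ → 𝓔₁₃` of bibundles over
`Y^[3] ≅ {((y₁, y₂), (y₂', y₃)) ∈ Y^[2] × Y^[2] | y₂ = y₂'}` (equivalently, a global central section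
of `(𝓔₁₂ 𝓔₂₃ 𝓔₁₃⁻¹)⁻¹`), subject to the cocycle condition over `Y^[4]`, which says that the two
ways of composing `𝓔₁₂ 𝓔₂₃ 𝓔₃₄ → 𝓔₁₄` agree. -/
structure BundleGerbe (VY : Type*) [NormedAddCommGroup VY] [NormedSpace ℝ VY] [ChartedSpace VY Y]
    (℘ : Y → M)
    (VH : Type*) [NormedAddCommGroup VH] [NormedSpace ℝ VH]
    (H : Type u) [Group H] [TopologicalSpace H] [ChartedSpace VH H]
    (VE : Type*) [NormedAddCommGroup VE] [NormedSpace ℝ VE] where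
  E : Bibundle (𝓘(ℝ, VY).prod 𝓘(ℝ, VY)) {y : Y × Y | ℘ y.1 = ℘ y.2} VH H VE
  f : E.carrier → E.carrier → E.carrier
  isProduct_f : IsBibundleProduct (fun y y' => y.2 = y'.1) (fun y y' => (y.1, y'.2)) E E E f
  cocycle : ∀ e e' e'', (E.proj e).2 = (E.proj e').1 → (E.proj e').2 = (E.proj e'').1 →
    f (f e e') e'' = f e (f e' e'')

variable {VY : Type*} [NormedAddCommGroup VY] [NormedSpace ℝ VY] [ChartedSpace VY Y]
  {℘ : Y → M}
  {VH : Type*} [NormedAddCommGroup VH] [NormedSpace ℝ VH]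
  {H : Type u} [Group H] [TopologicalSpace H] [ChartedSpace VH H]
  {VE : Type*} [NormedAddCommGroup VE] [NormedSpace ℝ VE]

/-- A trivialization of a bundle gerbe: an `H`-bibundle `𝓝` over `Y` with an isomorphism
`β : 𝓝₁⁻¹ 𝓝₂ → 𝓔` of bibundles over `Y^[2]`, `β n n'` being the image of `[n⁻¹, n']`, under which
`f` corresponds to the canonical contraction `𝓝₁⁻¹ 𝓝₂ 𝓝₂⁻¹ 𝓝₃ → 𝓝₁⁻¹ 𝓝₃`.
A bundle gerbe is trivial if it has a trivialization. -/
structure BundleGerbe.Trivialization (𝒢 : BundleGerbe VY ℘ VH H VE)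
    (VN : Type*) [NormedAddCommGroup VN] [NormedSpace ℝ VN] where
  N : Bibundle 𝓘(ℝ, VY) (Set.univ : Set Y) VH H VN
  β : N.carrier → N.carrier → 𝒢.E.carrier
  isProduct_β : IsBibundleProduct (fun y y' => ℘ y = ℘ y') (fun y y' => (y, y')) N.inv N 𝒢.E β
  f_β : ∀ n₁ n₂ n₃, ℘ (N.proj n₁) = ℘ (N.proj n₂) → ℘ (N.proj n₂) = ℘ (N.proj n₃) →
    𝒢.f (β n₁ n₂) (β n₂ n₃) = β n₁ n₃

variable {VD : Type*} [NormedAddCommGroup VD] [NormedSpace ℝ VD]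
  {D : Type u} [Group D] [TopologicalSpace D] [ChartedSpace VD D]

/-- A module over a bundle gerbe: a `D`-`H` bundle `𝓠` over `Y` with an isomorphism
`z : 𝓠₁ 𝓔 → 𝓠₂` of `D`-`H` bundles over `Y^[2]`, such that the two composites
`𝓠₁ 𝓔₁₂ 𝓔₂₃ → 𝓠₃` over `Y^[3]` agree. -/
structure GerbeModule (X : LieCrossedModule VH VD H D) (𝒢 : BundleGerbe VY ℘ VH H VE) where
  Q : DHBundle X VY Y
  z : Q.carrier → 𝒢.E.carrier → Q.carrier
  isProduct_z : IsDHProduct (fun y w => y = w.1) (fun _ w => w.2) Q 𝒢.E Q z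
  compat : ∀ q e e', Q.proj q = (𝒢.E.proj e).1 → (𝒢.E.proj e).2 = (𝒢.E.proj e').1 →
    z (z q e) e' = z q (𝒢.f e e')

namespace GerbeModule

variable {X : LieCrossedModule VH VD H D} {𝒢 : BundleGerbe VY ℘ VH H VE}

/-- A morphism of modules: a morphism of `D`-`H` bundles over `Y` compatible with the
structure isomorphisms `z`. -/
@[ext]
structure Hom (K K' : GerbeModule X 𝒢) where
  hom : K.Q ⟶ K'.Q
  z_eq : ∀ q e, K.Q.proj q = (𝒢.E.proj e).1 →
    DHBundle.Hom.toFun hom (K.z q e) = K'.z (DHBundle.Hom.toFun hom q) e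

instance : Category (GerbeModule X 𝒢) where
  Hom := Hom
  id K := ⟨𝟙 K.Q, fun _ _ _ => rfl⟩
  comp {K K' K''} u v := ⟨u.hom ≫ v.hom, fun q e h => by
    show v.hom.toFun (u.hom.toFun _) = K''.z (v.hom.toFun (u.hom.toFun q)) e
    rw [u.z_eq q e h, v.z_eq _ e ((u.hom.proj_eq q).trans h)]⟩

end GerbeModule

variable {X : LieCrossedModule VH VD H D} {𝒢 : BundleGerbe VY ℘ VH H VE}
  {VN : Type*} [NormedAddCommGroup VN] [NormedSpace ℝ VN]
  {VM : Type*} [NormedAddCommGroup VM] [NormedSpace ℝ VM] [TopologicalSpace M] [ChartedSpace VM M]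

/-- `δ` exhibits the `D`-`H` bundle `P` over `M` as the bundle obtained by descent from `𝓠 𝓝⁻¹`:
`[q, n⁻¹] ↦ δ q n` is an isomorphism from `𝓠 𝓝⁻¹` to the pull-back of `P` along `℘`, and it
carries the descent isomorphism
`𝓠₁ 𝓝₁⁻¹ → 𝓠₂ 𝓝₂⁻¹`, `[q, n⁻¹] ↦ [z (q, β(n, n')), n'⁻¹]`, to the identity of `P`. -/
structure IsDescent (𝒯 : 𝒢.Trivialization VN) (K : GerbeModule X 𝒢) (P : DHBundle X VM M)
    (δ : K.Q.carrier → 𝒯.N.carrier → P.carrier) : Prop where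
  isProduct : IsDHProduct (fun y y' => y = y') (fun y _ => ℘ y) K.Q 𝒯.N.inv P δ
  descent : ∀ q n n', K.Q.proj q = 𝒯.N.proj n → ℘ (𝒯.N.proj n) = ℘ (𝒯.N.proj n') →
    δ (K.z q (𝒯.β n n')) n' = δ q n

/-- `ε` exhibits the module `K` as `℘^*(P) 𝓝`: `[p, n] ↦ ε p n` is an isomorphism
from the `D`-`H` bundle `℘^*(P) 𝓝` over `Y` to the underlying `D`-`H` bundle of `K`, and it
carries the canonical map `(℘^*(P) 𝓝)₁ 𝓔 → (℘^*(P) 𝓝)₂`,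
`[[p, n], β(n, n')] ↦ [p, n']`, to the structure map of `K`. -/
structure IsTwist (𝒯 : 𝒢.Trivialization VN) (P : DHBundle X VM M) (K : GerbeModule X 𝒢)
    (ε : P.carrier → 𝒯.N.carrier → K.Q.carrier) : Prop where
  isProduct : IsDHProduct (fun x y => x = ℘ y) (fun _ y => y) P 𝒯.N K.Q ε
  z_eq : ∀ p n n', P.proj p = ℘ (𝒯.N.proj n) → ℘ (𝒯.N.proj n) = ℘ (𝒯.N.proj n') →
    K.z (ε p n) (𝒯.β n n') = ε p n'

end Gerbes

/-! The trivialization identifies 𝓔 with 𝓝₁⁻¹𝓝₂ over Y^[2], so a module structure 𝓠₁𝓔 → 𝓠₂ is the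
same thing as an isomorphism 𝓠₁𝓝₁⁻¹ → 𝓠₂𝓝₂⁻¹. Compatibility with f is the cocycle condition for this
isomorphism, because `f_β` makes f the contraction of 𝓝₂𝓝₂⁻¹. Hence 𝓠𝓝⁻¹ descends to M. Conversely
℘^*(P)𝓝 is a module by cancelling 𝓝₁𝓝₁⁻¹. The two constructions are inverse up to q ↦ [[q, n⁻¹], n]
and p ↦ [[p, n], n⁻¹].

The objects are not built as quotients. `GerbeModule.exists_isDescent` and `DHBundle.exists_isTwist`
produce some bundle, or module, with the characterizing map δ, or ε. For this a point `n₀` of 𝓝 is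
chosen over each base point, without continuity, and the total space is the set of representatives
with second entry `n₀`. The smooth structure comes from `PrincipalBundleCore`: local sections of ℘,
𝓝 and of the given bundle yield sections of the new one, whose transition functions are smooth and
do not involve `n₀`.

Everything else follows from the properties of δ and ε: their values exhaust the new bundle, so a
morphism is determined by them, and it exists as soon as it is independent of the representative.
Smoothness always reduces to two facts: division in a principal bundle is smooth
(`contMDiffWithinAt_torsorDiv`), and an equivariant map is smooth if it is so along local sections.
As all morphisms are isomorphisms, the two natural comparison maps give an equivalence. -/

/-! ### Division in the fibres of a principal bundle -/

section TorsorDivision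

/-- The element `g` with `act g q = p`, if there is one. -/
noncomputable def torsorDiv {G P : Type*} [Group G] (act : G → P → P) (p q : P) : G :=
  Classical.epsilon fun g => act g q = p

namespace IsPrincipalBundle

variable {EB HB : Type*} [NormedAddCommGroup EB] [NormedSpace ℝ EB] [TopologicalSpace HB]
  {B : Type u} [TopologicalSpace B] [ChartedSpace HB B]
  {I : ModelWithCorners ℝ EB HB} {S : Set B}
  {VG : Type*} [NormedAddCommGroup VG] [NormedSpace ℝ VG]
  {HG : Type*} [TopologicalSpace HG] {IG : ModelWithCorners ℝ VG HG}
  {G : Type u} [Group G] [TopologicalSpace G] [ChartedSpace HG G]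
  {VP : Type*} [NormedAddCommGroup VP] [NormedSpace ℝ VP]
  {HP : Type*} [TopologicalSpace HP] {IP : ModelWithCorners ℝ VP HP}
  {P : Type u} [TopologicalSpace P] [ChartedSpace HP P]
  {proj : P → B} {act : G → P → P}

/-- Freeness is hidden in the equivariance of the local coordinate: χ turns g p = g' p into g χ(p) =
g' χ(p). -/
theorem act_injective (hP : IsPrincipalBundle I S IG IP proj act) (p : P) :
    Function.Injective fun g => act g p := by
  intro g g' h
  obtain ⟨U, -, hb, s, χ, -, -, -, -, h2⟩ := hP.locally_trivial _ (hP.proj_mem p)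
  have := congrArg χ h
  simpa [h2 p hb] using this

theorem inv_act_act (hP : IsPrincipalBundle I S IG IP proj act) (g : G) (p : P) :
    act g⁻¹ (act g p) = p := by
  rw [← hP.mul_act, inv_mul_cancel, hP.one_act]

theorem act_inv_act (hP : IsPrincipalBundle I S IG IP proj act) (g : G) (p : P) :
    act g (act g⁻¹ p) = p := by
  rw [← hP.mul_act, mul_inv_cancel, hP.one_act]

/-- Both points are translates of the value of one local section, so their fibre coordinates can be
divided. -/
theorem exists_act_eq (hP : IsPrincipalBundle I S IG IP proj act) {p q : P}
    (h : proj p = proj q) : ∃ g, act g q = p := by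
  obtain ⟨U, -, hb, s, χ, -, -, -, h1, -⟩ := hP.locally_trivial _ (hP.proj_mem q)
  have hp := h1 p (by rwa [Set.mem_preimage, h])
  have hq := h1 q hb
  rw [h] at hp
  refine ⟨χ p * (χ q)⁻¹, ?_⟩
  have : act (χ p * (χ q)⁻¹) (act (χ q) (s (proj q))) = p := by
    rw [← hP.mul_act, inv_mul_cancel_right, hp]
  rwa [hq] at this

theorem exists_proj_eq (hP : IsPrincipalBundle I S IG IP proj act) {b : B} (hb : b ∈ S) :
    ∃ p, proj p = b := by
  obtain ⟨U, -, hU, s, -, -, hs, -⟩ := hP.locally_trivial b hb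
  exact ⟨s b, hs b ⟨hU, hb⟩⟩

theorem torsorDiv_act_eq (hP : IsPrincipalBundle I S IG IP proj act) {p q : P}
    (h : proj p = proj q) : act (torsorDiv act p q) q = p :=
  Classical.epsilon_spec (hP.exists_act_eq h)

theorem torsorDiv_eq (hP : IsPrincipalBundle I S IG IP proj act) {p q : P} {g : G}
    (h : act g q = p) : torsorDiv act p q = g := by
  refine hP.act_injective q ?_
  show act _ q = act g q
  rw [h, hP.torsorDiv_act_eq]
  rw [← h, hP.proj_act]

/-- Local sections of a principal bundle over an entire manifold. -/
theorem exists_section (hP : IsPrincipalBundle I Set.univ IG IP proj act) (b : B) :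
    ∃ U : Set B, IsOpen U ∧ b ∈ U ∧ ∃ s : B → P, ContMDiffOn I IP ∞ s U ∧
      ∀ x ∈ U, proj (s x) = x := by
  obtain ⟨U, hU, hb, s, -, h1, h2, -⟩ := hP.locally_trivial b trivial
  rw [Set.inter_univ] at h1 h2
  exact ⟨U, hU, hb, s, h1, h2⟩

variable {EX HX : Type*} [NormedAddCommGroup EX] [NormedSpace ℝ EX] [TopologicalSpace HX]
  {IX : ModelWithCorners ℝ EX HX} {X : Type*} [TopologicalSpace X] [ChartedSpace HX X]
  {W : Set X} {x : X}

theorem contMDiffWithinAt_act (hP : IsPrincipalBundle I S IG IP proj act) {g : X → G} {p : X → P}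
    (hg : ContMDiffWithinAt IX IG ∞ g W x) (hp : ContMDiffWithinAt IX IP ∞ p W x) :
    ContMDiffWithinAt IX IP ∞ (fun w => act (g w) (p w)) W x :=
  ContMDiffAt.comp_contMDiffWithinAt (g := fun y : G × P => act y.1 y.2) x
    hP.smooth_act.contMDiffAt (hg.prodMk hp)

/-- Division in the fibres of a principal bundle is smooth. -/
theorem contMDiffWithinAt_torsorDiv [LieGroup IG ∞ G]
    (hP : IsPrincipalBundle I S IG IP proj act) {p q : X → P}
    (hp : ContMDiffWithinAt IX IP ∞ p W x) (hq : ContMDiffWithinAt IX IP ∞ q W x)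
    (hx : x ∈ W) (h : ∀ w ∈ W, proj (p w) = proj (q w)) :
    ContMDiffWithinAt IX IG ∞ (fun w => torsorDiv act (p w) (q w)) W x := by
  obtain ⟨U, hU, hb, s, χ, -, -, hχ, h1, h2⟩ := hP.locally_trivial _ (hP.proj_mem (q x))
  have hU' : IsOpen (proj ⁻¹' U) := hU.preimage hP.smooth_proj.continuous
  have hpx : p x ∈ proj ⁻¹' U := by rwa [Set.mem_preimage, h x hx]
  -- Over a trivializing open set the quotient of p by q is χ(p) χ(q)⁻¹, which is visibly smooth.
  have e : ContMDiffWithinAt IX IG ∞ (fun w => χ (p w) * (χ (q w))⁻¹) W x :=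
    ((hχ.contMDiffAt (hU'.mem_nhds hpx)).comp_contMDiffWithinAt x hp).mul
      ((hχ.contMDiffAt (hU'.mem_nhds hb)).comp_contMDiffWithinAt x hq).inv
  have key : ∀ w ∈ W, q w ∈ proj ⁻¹' U →
      torsorDiv act (p w) (q w) = χ (p w) * (χ (q w))⁻¹ := by
    intro w hw hqw
    obtain ⟨g, hg⟩ := hP.exists_act_eq (h w hw)
    rw [hP.torsorDiv_eq hg, ← hg, h2 _ hqw, mul_inv_cancel_right]
  refine e.congr_of_eventuallyEq ?_ (key x hx hb)
  filter_upwards [self_mem_nhdsWithin, hq.continuousWithinAt (hU'.mem_nhds hb)] with w hw hqw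
  exact key w hw hqw

theorem contMDiffOn_torsorDiv_section [LieGroup IG ∞ G]
    (hP : IsPrincipalBundle I S IG IP proj act) {U : Set B} {s : B → P}
    (hs : ContMDiffOn I IP ∞ s U) (h : ∀ x ∈ U, proj (s x) = x) :
    ContMDiffOn IP IG ∞ (fun p => torsorDiv act p (s (proj p))) (proj ⁻¹' U) := fun p hp =>
  hP.contMDiffWithinAt_torsorDiv contMDiffWithinAt_id
    (hs.comp hP.smooth_proj.contMDiffOn (fun _ h => h) p hp) hp fun _ hw => (h _ hw).symm

/-- A map on a principal bundle, depending on parameters, is smooth if it is so after composition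
with local sections and the action. -/
theorem contMDiffAt_of_section [LieGroup IG ∞ G]
    (hP : IsPrincipalBundle I S IG IP proj act)
    {EK HK : Type*} [NormedAddCommGroup EK] [NormedSpace ℝ EK] [TopologicalSpace HK]
    {IK : ModelWithCorners ℝ EK HK} {K : Type*} [TopologicalSpace K] [ChartedSpace HK K]
    {f : P → K → X} {U : Set B} {p : P} (k : K) {s : B → P} (hU : IsOpen U) (hp : proj p ∈ U)
    (hs : ContMDiffOn I IP ∞ s U) (h : ∀ x ∈ U, proj (s x) = x)
    (hf : ContMDiffOn (IG.prod (I.prod IK)) IX ∞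
      (fun y : G × (B × K) => f (act y.1 (s y.2.1)) y.2.2) (Set.univ ×ˢ (U ×ˢ Set.univ))) :
    ContMDiffAt (IP.prod IK) IX ∞ (fun y : P × K => f y.1 y.2) (p, k) := by
  have hU' : IsOpen ((proj ⁻¹' U) ×ˢ (Set.univ : Set K)) :=
    (hU.preimage hP.smooth_proj.continuous).prod isOpen_univ
  -- The section gives smooth coordinates on P: a point is its quotient by the section value below
  -- it, acting on that value.
  have h1 : ContMDiffOn (IP.prod IK) IG ∞
      (fun y : P × K => torsorDiv act y.1 (s (proj y.1))) ((proj ⁻¹' U) ×ˢ Set.univ) :=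
    (hP.contMDiffOn_torsorDiv_section hs h).comp contMDiffOn_fst fun y hy => hy.1
  have h2 := hf.comp (h1.prodMk ((hP.smooth_proj.comp contMDiff_fst).contMDiffOn.prodMk
    contMDiffOn_snd)) fun y hy => ⟨trivial, hy.1, trivial⟩
  refine (h2.congr fun y hy => ?_).contMDiffAt (hU'.mem_nhds ⟨hp, trivial⟩)
  exact congrArg (f · y.2) (hP.torsorDiv_act_eq (h _ hy.1).symm).symm

end IsPrincipalBundle

end TorsorDivision

/-! ### Local sections of submersions -/

section Submersions

variable {VM : Type*} [NormedAddCommGroup VM] [NormedSpace ℝ VM]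
  {VY : Type*} [NormedAddCommGroup VY] [NormedSpace ℝ VY]
  {M : Type u} [TopologicalSpace M] [ChartedSpace VM M]
  {Y : Type u} [TopologicalSpace Y] [ChartedSpace VY Y]

/-- A submersion has smooth local sections. -/
theorem Manifold.IsSubmersionAt.exists_section {f : Y → M} {y : Y}
    (h : Manifold.IsSubmersionAt 𝓘(ℝ, VY) 𝓘(ℝ, VM) ∞ f y) :
    ∃ U : Set M, IsOpen U ∧ f y ∈ U ∧ ∃ s : M → Y, ContMDiffOn 𝓘(ℝ, VM) 𝓘(ℝ, VY) ∞ s U ∧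
      ∀ x ∈ U, f (s x) = x := by
  -- In suitable charts the submersion is a linear projection. The map `c` is its affine section
  -- through the coordinates of y: the complementary coordinate is frozen at its value there.
  let c : VM → VY := fun v => h.equiv.symm (v, (h.equiv (h.domChart y)).2)
  have hc : ContDiff ℝ ∞ c := h.equiv.symm.contDiff.comp (contDiff_id.prodMk contDiff_const)
  have hw := h.writtenInCharts
  have hcy : c (h.codChart (f y)) = h.domChart y := by
    have := hw (x := h.domChart y) (by simpa using h.domChart.map_source h.mem_domChart_source)
    simp only [mfld_simps, Function.comp, h.domChart.left_inv h.mem_domChart_source] at this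
    simp [c, this]
  refine ⟨h.codChart.source ∩ h.codChart ⁻¹' (c ⁻¹' h.domChart.target), ?_, ?_,
    fun x => h.domChart.symm (c (h.codChart x)), ?_, ?_⟩
  · exact h.codChart.isOpen_inter_preimage (h.domChart.open_target.preimage hc.continuous)
  · refine ⟨h.mem_codChart_source, ?_⟩
    rw [Set.mem_preimage, Set.mem_preimage, hcy]
    exact h.domChart.map_source h.mem_domChart_source
  · refine (contMDiffOn_symm_of_mem_maximalAtlas h.domChart_mem_maximalAtlas).comp
      (hc.contMDiff.comp_contMDiffOn
        ((contMDiffOn_of_mem_maximalAtlas h.codChart_mem_maximalAtlas).mono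
          Set.inter_subset_left)) fun x hx => hx.2
  · rintro x ⟨hx, hx'⟩
    have := hw (x := c (h.codChart x)) (by simpa using hx')
    simp only [mfld_simps, Function.comp] at this
    refine h.codChart.injOn (h.source_subset_preimage_source (h.domChart.map_target hx')) hx ?_
    rw [this]
    simp [c]

end Submersions

/-! ### Principal bundles from sections with smooth transition functions -/

section Construction

/-- A set `P` with a fibrewise simply transitive action of a Lie group `D` over a manifold `B`,
and local sections that differ by smooth transition functions. -/
structure PrincipalBundleCore {VB : Type*} [NormedAddCommGroup VB] [NormedSpace ℝ VB]
    {B : Type u} [TopologicalSpace B] [ChartedSpace VB B]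
    {VD : Type*} [NormedAddCommGroup VD] [NormedSpace ℝ VD]
    {D : Type u} [Group D] [TopologicalSpace D] [ChartedSpace VD D]
    {P : Type u} (proj : P → B) (act : D → P → P) where
  one_act : ∀ p, act 1 p = p
  mul_act : ∀ g g' p, act (g * g') p = act g (act g' p)
  proj_act : ∀ g p, proj (act g p) = proj p
  act_injective : ∀ p, Function.Injective fun g => act g p
  exists_act_eq : ∀ p q, proj p = proj q → ∃ g, act g q = p
  U : B → Set B
  isOpen_U : ∀ b, IsOpen (U b)
  mem_U : ∀ b, b ∈ U b
  s : B → B → P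
  proj_s : ∀ b, ∀ x ∈ U b, proj (s b x) = x
  exists_transition : ∀ b b', ∃ τ : B → D, ContMDiffOn 𝓘(ℝ, VB) 𝓘(ℝ, VD) ∞ τ (U b ∩ U b') ∧
    ∀ x ∈ U b ∩ U b', act (τ x) (s b' x) = s b x

namespace PrincipalBundleCore

variable {VB : Type*} [NormedAddCommGroup VB] [NormedSpace ℝ VB]
  {B : Type u} [TopologicalSpace B] [ChartedSpace VB B]
  {VD : Type*} [NormedAddCommGroup VD] [NormedSpace ℝ VD]
  {D : Type u} [Group D] [TopologicalSpace D] [ChartedSpace VD D]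
  {P : Type u} {proj : P → B} {act : D → P → P}

section Trivializations

variable (Z : PrincipalBundleCore (VB := VB) (VD := VD) proj act)

include Z in
theorem act_torsorDiv {p q : P} (h : proj p = proj q) : act (torsorDiv act p q) q = p :=
  Classical.epsilon_spec (Z.exists_act_eq p q h)

include Z in
theorem torsorDiv_act (g : D) (q : P) : torsorDiv act (act g q) q = g :=
  Z.act_injective q (Classical.epsilon_spec (p := fun k => act k q = act g q) ⟨g, rfl⟩)

/-- The trivialization of `P` over `U b` given by the section `s b`. -/
noncomputable def triv (b : B) : PartialEquiv P (B × D) where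
  toFun p := (proj p, torsorDiv act p (Z.s b (proj p)))
  invFun x := act x.2 (Z.s b x.1)
  source := proj ⁻¹' Z.U b
  target := Z.U b ×ˢ Set.univ
  map_source' p hp := ⟨hp, trivial⟩
  map_target' x hx := by
    rw [Set.mem_preimage, Z.proj_act, Z.proj_s b _ hx.1]
    exact hx.1
  left_inv' p hp := Z.act_torsorDiv (Z.proj_s b _ hp).symm
  right_inv' x hx := by
    rw [Z.proj_act, Z.proj_s b _ hx.1, Z.torsorDiv_act]

theorem triv_act_snd (b : B) {p : P} (hp : proj p ∈ Z.U b) (g : D) :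
    (Z.triv b (act g p)).2 = g * (Z.triv b p).2 := by
  refine Z.act_injective (Z.s b (proj p)) ?_
  have h1 : act (Z.triv b (act g p)).2 (Z.s b (proj (act g p))) = act g p :=
    (Z.triv b).left_inv (show proj (act g p) ∈ Z.U b by rwa [Z.proj_act])
  have h2 : act (Z.triv b p).2 (Z.s b (proj p)) = p := (Z.triv b).left_inv hp
  rw [Z.proj_act] at h1
  show act (Z.triv b (act g p)).2 (Z.s b (proj p)) = act (g * (Z.triv b p).2) (Z.s b (proj p))
  rw [Z.mul_act, h1, h2]

/-- In the fibre coordinate the change of trivialization is right multiplication by the transition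
function τ. -/
theorem contMDiffOn_triv_symm_trans [LieGroup 𝓘(ℝ, VD) ∞ D] (b b' : B) :
    ContMDiffOn (𝓘(ℝ, VB).prod 𝓘(ℝ, VD)) (𝓘(ℝ, VB).prod 𝓘(ℝ, VD)) ∞
      ((Z.triv b).symm.trans (Z.triv b')) ((Z.U b ∩ Z.U b') ×ˢ Set.univ) := by
  obtain ⟨τ, hτ, h⟩ := Z.exists_transition b b'
  have hs : ContMDiffOn (𝓘(ℝ, VB).prod 𝓘(ℝ, VD)) (𝓘(ℝ, VB).prod 𝓘(ℝ, VD)) ∞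
      (fun x : B × D => (x.1, x.2 * τ x.1)) ((Z.U b ∩ Z.U b') ×ˢ Set.univ) :=
    contMDiffOn_fst.prodMk (contMDiffOn_snd.mul (hτ.comp contMDiffOn_fst fun x hx => hx.1))
  refine hs.congr fun x hx => ?_
  show (proj (act x.2 (Z.s b x.1)), torsorDiv act (act x.2 (Z.s b x.1))
    (Z.s b' (proj (act x.2 (Z.s b x.1))))) = _
  rw [Z.proj_act, Z.proj_s b _ hx.1.1, ← h _ hx.1, ← Z.mul_act, Z.torsorDiv_act]

theorem triv_symm_trans_source (b b' : B) :
    ((Z.triv b).symm.trans (Z.triv b')).source = (Z.U b ∩ Z.U b') ×ˢ Set.univ := by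
  ext x
  simp only [PartialEquiv.trans_source, PartialEquiv.symm_source, Set.mem_inter_iff,
    Set.mem_preimage, Set.mem_prod, Set.mem_univ, and_true]
  constructor
  · rintro ⟨h, h'⟩
    refine ⟨h.1, ?_⟩
    have : proj (act x.2 (Z.s b x.1)) ∈ Z.U b' := h'
    rwa [Z.proj_act, Z.proj_s b _ h.1] at this
  · rintro ⟨h, h'⟩
    refine ⟨⟨h, trivial⟩, ?_⟩
    show proj (act x.2 (Z.s b x.1)) ∈ Z.U b'
    rwa [Z.proj_act, Z.proj_s b _ h]

/-- The change of trivializations. -/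
noncomputable def change [LieGroup 𝓘(ℝ, VD) ∞ D] (b b' : B) :
    OpenPartialHomeomorph (B × D) (B × D) where
  toPartialEquiv := (Z.triv b).symm.trans (Z.triv b')
  open_source := by
    rw [triv_symm_trans_source]
    exact ((Z.isOpen_U b).inter (Z.isOpen_U b')).prod isOpen_univ
  open_target := by
    show IsOpen ((Z.triv b').symm.trans (Z.triv b)).source
    rw [triv_symm_trans_source]
    exact ((Z.isOpen_U b').inter (Z.isOpen_U b)).prod isOpen_univ
  continuousOn_toFun := by
    rw [triv_symm_trans_source]
    exact (Z.contMDiffOn_triv_symm_trans b b').continuousOn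
  continuousOn_invFun := by
    show ContinuousOn ((Z.triv b').symm.trans (Z.triv b)) ((Z.triv b').symm.trans (Z.triv b)).source
    rw [triv_symm_trans_source]
    exact (Z.contMDiffOn_triv_symm_trans b' b).continuousOn

theorem contMDiffOn_change [LieGroup 𝓘(ℝ, VD) ∞ D] (b b' : B) :
    ContMDiffOn (𝓘(ℝ, VB).prod 𝓘(ℝ, VD)) (𝓘(ℝ, VB).prod 𝓘(ℝ, VD)) ∞
      (Z.change b b') (Z.change b b').source := by
  show ContMDiffOn _ _ ∞ ((Z.triv b).symm.trans (Z.triv b'))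
    ((Z.triv b).symm.trans (Z.triv b')).source
  rw [triv_symm_trans_source]
  exact Z.contMDiffOn_triv_symm_trans b b'

variable [LieGroup 𝓘(ℝ, VD) ∞ D]

/-- The chart of `P` obtained from the trivialization over `U b` and the chart of `B × D` at `x`. -/
noncomputable def chart (b : B) (x : B × D) : PartialEquiv P (ModelProd VB VD) :=
  (Z.triv b).trans (chartAt (ModelProd VB VD) x).toPartialEquiv

/-- The change of charts. -/
noncomputable def chartChange (b b' : B) (x x' : B × D) :
    OpenPartialHomeomorph (ModelProd VB VD) (ModelProd VB VD) :=
  (chartAt (ModelProd VB VD) x).symm ≫ₕ (Z.change b b' ≫ₕ chartAt (ModelProd VB VD) x')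

/-- The charts are bijections on a bare set, but their changes involve only B × D and the model
space, where continuity and smoothness make sense. -/
theorem chart_symm_trans (b b' : B) (x x' : B × D) :
    (Z.chart b x).symm.trans (Z.chart b' x') = (Z.chartChange b b' x x').toPartialEquiv := by
  simp only [chart, chartChange, PartialEquiv.trans_symm_eq_symm_trans_symm,
    PartialEquiv.trans_assoc, OpenPartialHomeomorph.trans_toPartialEquiv,
    OpenPartialHomeomorph.symm_toPartialEquiv, change]

/-- The manifold charts of `P`. -/
noncomputable def chartedCore : ChartedSpaceCore (ModelProd VB VD) P where
  atlas := Set.range fun y : B × (B × D) => Z.chart y.1 y.2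
  chartAt p := Z.chart (proj p) (Z.triv (proj p) p)
  mem_chart_source p := by
    refine ⟨Z.mem_U _, ?_⟩
    exact mem_chart_source (ModelProd VB VD) (Z.triv (proj p) p)
  chart_mem_atlas p := ⟨(_, _), rfl⟩
  open_source := by
    rintro _ _ ⟨⟨b, x⟩, rfl⟩ ⟨⟨b', x'⟩, rfl⟩
    rw [chart_symm_trans]
    exact (Z.chartChange b b' x x').open_source
  continuousOn_toFun := by
    rintro _ _ ⟨⟨b, x⟩, rfl⟩ ⟨⟨b', x'⟩, rfl⟩
    rw [chart_symm_trans]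
    exact (Z.chartChange b b' x x').continuousOn

end Trivializations

/-- The total space of the bundle constructed from a core. -/
def Total (_ : PrincipalBundleCore (VB := VB) (VD := VD) proj act) : Type u := P

variable (Z : PrincipalBundleCore (VB := VB) (VD := VD) proj act) [LieGroup 𝓘(ℝ, VD) ∞ D]

noncomputable instance : TopologicalSpace Z.Total := Z.chartedCore.toTopologicalSpace

noncomputable instance : ChartedSpace (ModelProd VB VD) Z.Total := Z.chartedCore.toChartedSpace

/-- The atlas consists of the set-theoretic charts promoted to homeomorphisms; the underlying
partial equivalence is all that is needed, since it determines the homeomorphism. -/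
theorem exists_eq_of_mem_atlas {e : OpenPartialHomeomorph Z.Total (ModelProd VB VD)}
    (he : e ∈ atlas (ModelProd VB VD) Z.Total) :
    ∃ b x, e.toPartialEquiv = Z.chart b x := by
  obtain ⟨_, ⟨e', rfl⟩, _, ⟨⟨⟨b, x⟩, rfl⟩, rfl⟩, h⟩ := he
  refine ⟨b, x, ?_⟩
  rw [Set.mem_singleton_iff.1 h]
  rfl

theorem contMDiffOn_chartChange [IsManifold 𝓘(ℝ, VB) ∞ B] (b b' : B) (x x' : B × D) :
    ContMDiffOn (𝓘(ℝ, VB).prod 𝓘(ℝ, VD)) (𝓘(ℝ, VB).prod 𝓘(ℝ, VD)) ∞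
      (Z.chartChange b b' x x') (Z.chartChange b b' x x').source := by
  have : IsManifold 𝓘(ℝ, VD) ∞ D := ContMDiffMul.toIsManifold
  refine (contMDiffOn_chart (x := x')).comp ((Z.contMDiffOn_change b b').comp
    ((contMDiffOn_chart_symm (x := x)).mono ?_) ?_) ?_
  · intro v hv
    exact hv.1
  · intro v hv
    exact hv.2.1
  · intro v hv
    exact hv.2.2

instance [IsManifold 𝓘(ℝ, VB) ∞ B] :
    IsManifold (𝓘(ℝ, VB).prod 𝓘(ℝ, VD)) ∞ Z.Total := by
  refine isManifold_of_contDiffOn _ _ _ fun e e' he he' => ?_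
  obtain ⟨b, x, h⟩ := Z.exists_eq_of_mem_atlas he
  obtain ⟨b', x', h'⟩ := Z.exists_eq_of_mem_atlas he'
  have key : e.symm ≫ₕ e' = Z.chartChange b b' x x' := by
    refine OpenPartialHomeomorph.toPartialEquiv_injective ?_
    show (e.symm ≫ₕ e').toPartialEquiv = (Z.chartChange b b' x x').toPartialEquiv
    rw [← chart_symm_trans, ← h, ← h']
    rfl
  rw [key, ← contMDiffOn_iff_contDiffOn]
  refine (ModelWithCorners.contMDiff _).comp_contMDiffOn ((Z.contMDiffOn_chartChange b b' x x').comp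
    ((ModelWithCorners.contMDiffOn_symm _).mono Set.inter_subset_right) fun v hv => hv.1)

/-- The projection of the bundle constructed from a core. -/
def projection (p : Z.Total) : B := proj p

/-- The group action on the bundle constructed from a core. -/
def action (g : D) (p : Z.Total) : Z.Total := act g p

/-- A local section of the bundle constructed from a core. -/
def localSection (b x : B) : Z.Total := Z.s b x

/-- The trivialization over `U b` of the bundle constructed from a core. -/
noncomputable def localTriv (b : B) : PartialEquiv Z.Total (B × D) := Z.triv b

/-- The smoothness proofs below use the preferred chart only through this factorization over the
trivialization at the base point of `p`. -/
theorem exists_chartAt_eq (p : Z.Total) : ∃ x : B × D,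
    p ∈ (chartAt (ModelProd VB VD) p).source ∧
    (chartAt (ModelProd VB VD) p).toPartialEquiv = Z.chart (Z.projection p) x :=
  ⟨_, mem_chart_source _ p, rfl⟩

variable [IsManifold 𝓘(ℝ, VB) ∞ B]

/-- The trivialization is the preferred chart followed by an inverse chart of B × D. Only the index
belonging to `p` is treated: for other indices the domain is known to be open only once the
projection is continuous, and that is deduced from this lemma. -/
theorem contMDiffAt_triv_self (p : Z.Total) :
    ContMDiffAt (𝓘(ℝ, VB).prod 𝓘(ℝ, VD)) (𝓘(ℝ, VB).prod 𝓘(ℝ, VD)) ∞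
      (fun q : Z.Total => Z.localTriv (Z.projection p) q) p := by
  have : IsManifold 𝓘(ℝ, VD) ∞ D := ContMDiffMul.toIsManifold
  obtain ⟨x, hp, h⟩ := Z.exists_chartAt_eq p
  have hsource : ∀ q ∈ (chartAt (ModelProd VB VD) p).source,
      Z.localTriv (Z.projection p) q ∈ (chartAt (ModelProd VB VD) x).source := by
    intro q hq
    have hq' : q ∈ (chartAt (ModelProd VB VD) p).toPartialEquiv.source := hq
    rw [h] at hq'
    exact hq'.2
  have happ : ∀ q, chartAt (ModelProd VB VD) p q =
      chartAt (ModelProd VB VD) x (Z.localTriv (Z.projection p) q) := fun q =>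
    congrArg (fun e : PartialEquiv Z.Total (ModelProd VB VD) => e q) h
  have h1 : ContMDiffOn (𝓘(ℝ, VB).prod 𝓘(ℝ, VD)) (𝓘(ℝ, VB).prod 𝓘(ℝ, VD)) ∞
      (fun q : Z.Total => (chartAt (ModelProd VB VD) x).symm (chartAt (ModelProd VB VD) p q))
      (chartAt (ModelProd VB VD) p).source := by
    refine (contMDiffOn_chart_symm (x := x)).comp contMDiffOn_chart fun q hq => ?_
    rw [Set.mem_preimage, happ]
    exact (chartAt (ModelProd VB VD) x).map_source (hsource q hq)
  refine (h1.congr fun q hq => ?_).contMDiffAt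
    ((chartAt (ModelProd VB VD) p).open_source.mem_nhds hp)
  rw [happ, OpenPartialHomeomorph.left_inv _ (hsource q hq)]

theorem contMDiff_projection : ContMDiff (𝓘(ℝ, VB).prod 𝓘(ℝ, VD)) 𝓘(ℝ, VB) ∞ Z.projection :=
  fun p => (Z.contMDiffAt_triv_self p).fst

/-- Near each point, this is the trivialization belonging to that point followed by a smooth change
of trivialization. -/
theorem contMDiffOn_triv (b : B) :
    ContMDiffOn (𝓘(ℝ, VB).prod 𝓘(ℝ, VD)) (𝓘(ℝ, VB).prod 𝓘(ℝ, VD)) ∞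
      (fun q : Z.Total => Z.localTriv b q) (Z.projection ⁻¹' Z.U b) := by
  intro p hp
  have hopen : IsOpen (Z.projection ⁻¹' (Z.U (Z.projection p) ∩ Z.U b)) :=
    ((Z.isOpen_U _).inter (Z.isOpen_U b)).preimage Z.contMDiff_projection.continuous
  have hmem : p ∈ Z.projection ⁻¹' (Z.U (Z.projection p) ∩ Z.U b) := ⟨Z.mem_U _, hp⟩
  have h2 : ContMDiffAt (𝓘(ℝ, VB).prod 𝓘(ℝ, VD)) (𝓘(ℝ, VB).prod 𝓘(ℝ, VD)) ∞
      (fun q : Z.Total => ((Z.triv (Z.projection p)).symm.trans (Z.triv b))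
        (Z.localTriv (Z.projection p) q)) p :=
    ((Z.contMDiffOn_triv_symm_trans (Z.projection p) b).contMDiffAt
      ((((Z.isOpen_U _).inter (Z.isOpen_U b)).prod isOpen_univ).mem_nhds
        (show Z.localTriv (Z.projection p) p ∈ (Z.U (Z.projection p) ∩ Z.U b) ×ˢ Set.univ from
          ⟨hmem, trivial⟩))).comp p (Z.contMDiffAt_triv_self p)
  refine (h2.congr_of_eventuallyEq ?_).contMDiffWithinAt
  filter_upwards [hopen.mem_nhds hmem] with q hq
  exact congrArg (Z.localTriv b) ((Z.localTriv (Z.projection p)).left_inv hq.1).symm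

theorem contMDiffAt_triv_symm_self (p : Z.Total) :
    ContMDiffAt (𝓘(ℝ, VB).prod 𝓘(ℝ, VD)) (𝓘(ℝ, VB).prod 𝓘(ℝ, VD)) ∞
      (fun y : B × D => ((Z.localTriv (Z.projection p)).symm y : Z.Total))
      (Z.localTriv (Z.projection p) p) := by
  have : IsManifold 𝓘(ℝ, VD) ∞ D := ContMDiffMul.toIsManifold
  obtain ⟨x, hp, h⟩ := Z.exists_chartAt_eq p
  have hp' : p ∈ (Z.chart (Z.projection p) x).source := h ▸ hp
  have happ : ∀ v, ((chartAt (ModelProd VB VD) p).symm v : Z.Total) =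
      (Z.localTriv (Z.projection p)).symm ((chartAt (ModelProd VB VD) x).symm v) := fun v =>
    congrArg (fun e : PartialEquiv Z.Total (ModelProd VB VD) => e.symm v) h
  have happ' : chartAt (ModelProd VB VD) p p =
      chartAt (ModelProd VB VD) x (Z.localTriv (Z.projection p) p) :=
    congrArg (fun e : PartialEquiv Z.Total (ModelProd VB VD) => e p) h
  have h1 : ContMDiffAt (𝓘(ℝ, VB).prod 𝓘(ℝ, VD)) (𝓘(ℝ, VB).prod 𝓘(ℝ, VD)) ∞
      (fun y : B × D => (chartAt (ModelProd VB VD) p).symm (chartAt (ModelProd VB VD) x y))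
      (Z.localTriv (Z.projection p) p) := by
    refine ContMDiffAt.comp (g := (chartAt (ModelProd VB VD) p).symm) _ ?_
      (contMDiffOn_chart.contMDiffAt
        ((chartAt (ModelProd VB VD) x).open_source.mem_nhds hp'.2))
    refine contMDiffOn_chart_symm.contMDiffAt
      ((chartAt (ModelProd VB VD) p).open_target.mem_nhds ?_)
    rw [← happ']
    exact (chartAt (ModelProd VB VD) p).map_source hp
  refine h1.congr_of_eventuallyEq ?_
  filter_upwards [(chartAt (ModelProd VB VD) x).open_source.mem_nhds hp'.2] with y hy
  rw [happ, OpenPartialHomeomorph.left_inv _ hy]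

theorem contMDiffOn_triv_symm (b : B) :
    ContMDiffOn (𝓘(ℝ, VB).prod 𝓘(ℝ, VD)) (𝓘(ℝ, VB).prod 𝓘(ℝ, VD)) ∞
      (fun y : B × D => ((Z.localTriv b).symm y : Z.Total)) (Z.U b ×ˢ Set.univ) := by
  rintro y ⟨hy, -⟩
  set p : Z.Total := (Z.localTriv b).symm y with hpdef
  have hpy : Z.projection p = y.1 := by
    show proj (act y.2 (Z.s b y.1)) = y.1
    rw [Z.proj_act, Z.proj_s b _ hy]
  have hopen : IsOpen ((Z.U b ∩ Z.U (Z.projection p)) ×ˢ (Set.univ : Set D)) :=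
    ((Z.isOpen_U b).inter (Z.isOpen_U _)).prod isOpen_univ
  have hmem : y ∈ (Z.U b ∩ Z.U (Z.projection p)) ×ˢ (Set.univ : Set D) :=
    ⟨⟨hy, hpy ▸ Z.mem_U _⟩, trivial⟩
  have h1 : ContMDiffAt (𝓘(ℝ, VB).prod 𝓘(ℝ, VD)) (𝓘(ℝ, VB).prod 𝓘(ℝ, VD)) ∞
      (fun y : B × D => ((Z.localTriv (Z.projection p)).symm
        (((Z.triv b).symm.trans (Z.triv (Z.projection p))) y) : Z.Total)) y :=
    ContMDiffAt.comp (g := fun y : B × D => ((Z.localTriv (Z.projection p)).symm y : Z.Total)) y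
      (Z.contMDiffAt_triv_symm_self p)
      ((Z.contMDiffOn_triv_symm_trans b (Z.projection p)).contMDiffAt (hopen.mem_nhds hmem))
  refine (h1.congr_of_eventuallyEq ?_).contMDiffWithinAt
  filter_upwards [hopen.mem_nhds hmem] with w hw
  rw [← triv_symm_trans_source] at hw
  exact ((Z.localTriv (Z.projection p)).left_inv hw.2).symm

theorem contMDiffOn_localSection (b : B) :
    ContMDiffOn 𝓘(ℝ, VB) (𝓘(ℝ, VB).prod 𝓘(ℝ, VD)) ∞ (Z.localSection b) (Z.U b) := by
  have h : ContMDiffOn 𝓘(ℝ, VB) (𝓘(ℝ, VB).prod 𝓘(ℝ, VD)) ∞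
      (fun x => ((Z.localTriv b).symm (x, (1 : D)) : Z.Total)) (Z.U b) :=
    (Z.contMDiffOn_triv_symm b).comp (contMDiffOn_id.prodMk contMDiffOn_const)
      fun x hx => ⟨hx, trivial⟩
  exact h.congr fun x _ => (Z.one_act (Z.s b x)).symm

/-- A core gives rise to a principal bundle. -/
theorem isPrincipalBundle :
    IsPrincipalBundle 𝓘(ℝ, VB) Set.univ 𝓘(ℝ, VD) (𝓘(ℝ, VB).prod 𝓘(ℝ, VD))
      Z.projection Z.action where
  one_act := Z.one_act
  mul_act := Z.mul_act
  smooth_act := by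
    -- In a trivialization the action is left multiplication on the fibre coordinate.
    rintro ⟨g, p⟩
    have hopen : IsOpen (Z.projection ⁻¹' Z.U (Z.projection p)) :=
      (Z.isOpen_U _).preimage Z.contMDiff_projection.continuous
    have ht : ContMDiffAt (𝓘(ℝ, VD).prod (𝓘(ℝ, VB).prod 𝓘(ℝ, VD)))
        (𝓘(ℝ, VB).prod 𝓘(ℝ, VD)) ∞
        (fun w : D × Z.Total => Z.localTriv (Z.projection p) w.2) (g, p) :=
      (Z.contMDiffAt_triv_self p).comp (g, p) contMDiffAt_snd
    have h1 : ContMDiffAt (𝓘(ℝ, VD).prod (𝓘(ℝ, VB).prod 𝓘(ℝ, VD)))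
        (𝓘(ℝ, VB).prod 𝓘(ℝ, VD)) ∞
        (fun w : D × Z.Total => ((Z.localTriv (Z.projection p)).symm
          ((Z.localTriv (Z.projection p) w.2).1, w.1 * (Z.localTriv (Z.projection p) w.2).2) : Z.Total))
        (g, p) :=
      ContMDiffAt.comp (g := fun y : B × D => ((Z.localTriv (Z.projection p)).symm y : Z.Total)) (g, p)
        ((Z.contMDiffOn_triv_symm _).contMDiffAt
          (((Z.isOpen_U _).prod isOpen_univ).mem_nhds ⟨Z.mem_U _, trivial⟩))
        (ht.fst.prodMk (contMDiffAt_fst.mul ht.snd))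
    refine h1.congr_of_eventuallyEq ?_
    filter_upwards [(hopen.preimage continuous_snd).mem_nhds
      (show (g, p) ∈ Prod.snd ⁻¹' (Z.projection ⁻¹' Z.U (Z.projection p)) from Z.mem_U _)]
      with w hw
    refine Eq.trans ?_ (Z.mul_act _ _ _).symm
    exact congrArg (act w.1) ((Z.localTriv (Z.projection p)).left_inv hw).symm
  smooth_proj := Z.contMDiff_projection
  proj_mem _ := trivial
  proj_act := Z.proj_act
  locally_trivial b _ := by
    refine ⟨Z.U b, Z.isOpen_U b, Z.mem_U b, Z.localSection b, fun p => (Z.localTriv b p).2,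
      ?_, ?_, ?_, ?_, ?_⟩
    · rw [Set.inter_univ]
      exact Z.contMDiffOn_localSection b
    · exact fun x hx => Z.proj_s b x hx.1
    · exact fun p hp => (Z.contMDiffOn_triv b p hp).snd
    · exact fun p hp => (Z.localTriv b).left_inv hp
    · exact fun p hp g => Z.triv_act_snd b hp g

end PrincipalBundleCore

end Construction

/-! ### The automorphisms φ_e of a bibundle -/

section BibundleAlgebra

namespace Bibundle

variable {EB HB : Type*} [NormedAddCommGroup EB] [NormedSpace ℝ EB] [TopologicalSpace HB]
  {B : Type u} [TopologicalSpace B] [ChartedSpace HB B]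
  {I : ModelWithCorners ℝ EB HB} {S : Set B}
  {VH : Type*} [NormedAddCommGroup VH] [NormedSpace ℝ VH]
  {H : Type u} [Group H] [TopologicalSpace H] [ChartedSpace VH H]
  {VE : Type*} [NormedAddCommGroup VE] [NormedSpace ℝ VE]
  (E : Bibundle I S VH H VE)

theorem proj_lact (h : H) (e : E.carrier) : E.proj (E.lact h e) = E.proj e :=
  E.isLeft.proj_act h e

theorem proj_ract (e : E.carrier) (h : H) : E.proj (E.ract e h) = E.proj e := by
  simpa using E.isRight.proj_act h⁻¹ e

theorem ract_mul (e : E.carrier) (h k : H) : E.ract e (h * k) = E.ract (E.ract e h) k := by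
  simpa using E.isRight.mul_act k⁻¹ h⁻¹ e

theorem ract_one (e : E.carrier) : E.ract e 1 = e := by
  simpa using E.isRight.one_act e

theorem exists_ract_eq {e e' : E.carrier} (h : E.proj e = E.proj e') :
    ∃ k, E.ract e' k = e := by
  obtain ⟨k, hk⟩ := E.isRight.exists_act_eq h
  exact ⟨k⁻¹, hk⟩

theorem phi_eq {e : E.carrier} {h k : H} (hk : E.lact k e = E.ract e h) : E.phi e h = k :=
  E.isLeft.act_injective e ((E.phi_spec e h).trans hk.symm)

theorem phi_mul (e : E.carrier) (h k : H) : E.phi e (h * k) = E.phi e h * E.phi e k := by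
  refine E.phi_eq ?_
  rw [E.isLeft.mul_act, E.phi_spec, ← E.comm, E.phi_spec, E.ract_mul]

theorem phi_one (e : E.carrier) : E.phi e 1 = 1 :=
  E.phi_eq (by rw [E.ract_one, E.isLeft.one_act])

theorem phi_inv_apply (e : E.carrier) (h : H) : E.phi e h⁻¹ = (E.phi e h)⁻¹ :=
  eq_inv_of_mul_eq_one_left (by rw [← E.phi_mul, inv_mul_cancel, E.phi_one])

/-- `E.inv.phi e k` is the h with e ◁ h⁻¹ = k⁻¹ e, so φ of the inverse bibundle inverts φ_e.
Smoothness of φ_e⁻¹ is thereby a case of smoothness of φ. -/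
theorem phi_inv_phi (e : E.carrier) (h : H) : E.inv.phi e (E.phi e h) = h := by
  refine E.inv.phi_eq ?_
  show E.ract e h⁻¹ = E.lact (E.phi e h)⁻¹ e
  rw [← E.phi_inv_apply, E.phi_spec]

theorem phi_phi_inv (e : E.carrier) (h : H) : E.phi e (E.inv.phi e h) = h := by
  rw [← inv_inj, ← E.phi_inv_apply]
  exact E.phi_eq (E.inv.phi_spec e h).symm

/-- The automorphism `φ_e` of `H`. -/
noncomputable def phiAut (e : E.carrier) : MulAut H where
  toFun := E.phi e
  invFun := E.inv.phi e
  left_inv := E.phi_inv_phi e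
  right_inv := E.phi_phi_inv e
  map_mul' := E.phi_mul e

variable {EX HX : Type*} [NormedAddCommGroup EX] [NormedSpace ℝ EX] [TopologicalSpace HX]
  {IX : ModelWithCorners ℝ EX HX} {X : Type*} [TopologicalSpace X] [ChartedSpace HX X]
  {W : Set X} {x : X}

theorem contMDiffWithinAt_ract [LieGroup 𝓘(ℝ, VH) ∞ H] {e : X → E.carrier} {h : X → H}
    (he : ContMDiffWithinAt IX 𝓘(ℝ, VE) ∞ e W x) (hh : ContMDiffWithinAt IX 𝓘(ℝ, VH) ∞ h W x) :
    ContMDiffWithinAt IX 𝓘(ℝ, VE) ∞ (fun w => E.ract (e w) (h w)) W x := by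
  simpa using E.isRight.contMDiffWithinAt_act hh.inv he

/-- φ_e(h) is the quotient of e ◁ h by e for the left action, and division is smooth. -/
theorem contMDiffWithinAt_phi [LieGroup 𝓘(ℝ, VH) ∞ H] {e : X → E.carrier} {h : X → H}
    (he : ContMDiffWithinAt IX 𝓘(ℝ, VE) ∞ e W x) (hh : ContMDiffWithinAt IX 𝓘(ℝ, VH) ∞ h W x)
    (hx : x ∈ W) :
    ContMDiffWithinAt IX 𝓘(ℝ, VH) ∞ (fun w => E.phi (e w) (h w)) W x := by
  have key : ∀ w, E.phi (e w) (h w) = torsorDiv E.lact (E.ract (e w) (h w)) (e w) := fun w =>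
    (E.isLeft.torsorDiv_eq (E.phi_spec _ _)).symm
  simp only [key]
  exact E.isLeft.contMDiffWithinAt_torsorDiv (E.contMDiffWithinAt_ract he hh) he hx
    fun w _ => E.proj_ract _ _

end Bibundle

end BibundleAlgebra

/-! ### Products of bibundles -/

section BibundleProducts

variable {E₁ H₁ : Type*} [NormedAddCommGroup E₁] [NormedSpace ℝ E₁] [TopologicalSpace H₁]
  {B₁ : Type u} [TopologicalSpace B₁] [ChartedSpace H₁ B₁]
  {E₂ H₂ : Type*} [NormedAddCommGroup E₂] [NormedSpace ℝ E₂] [TopologicalSpace H₂]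
  {B₂ : Type u} [TopologicalSpace B₂] [ChartedSpace H₂ B₂]
  {E₃ H₃ : Type*} [NormedAddCommGroup E₃] [NormedSpace ℝ E₃] [TopologicalSpace H₃]
  {B₃ : Type u} [TopologicalSpace B₃] [ChartedSpace H₃ B₃]
  {I₁ : ModelWithCorners ℝ E₁ H₁} {I₂ : ModelWithCorners ℝ E₂ H₂}
  {I₃ : ModelWithCorners ℝ E₃ H₃}
  {S₁ : Set B₁} {S₂ : Set B₂} {S₃ : Set B₃}
  {VH : Type*} [NormedAddCommGroup VH] [NormedSpace ℝ VH]
  {H : Type u} [Group H] [TopologicalSpace H] [ChartedSpace VH H]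
  {V₁ : Type*} [NormedAddCommGroup V₁] [NormedSpace ℝ V₁]
  {V₂ : Type*} [NormedAddCommGroup V₂] [NormedSpace ℝ V₂]
  {V₃ : Type*} [NormedAddCommGroup V₃] [NormedSpace ℝ V₃]
  {r : B₁ → B₂ → Prop} {c : B₁ → B₂ → B₃}
  {A₁ : Bibundle I₁ S₁ VH H V₁} {A₂ : Bibundle I₂ S₂ VH H V₂} {C : Bibundle I₃ S₃ VH H V₃}
  {m : A₁.carrier → A₂.carrier → C.carrier}

namespace IsBibundleProduct

/-- An element k moves from right to left through both factors: [a, a' ◁ k] = [a, φ_{a'}(k) a'] = [a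
◁ φ_{a'}(k), a'] = φ_a(φ_{a'}(k)) [a, a']. -/
theorem phi_eq (hm : IsBibundleProduct r c A₁ A₂ C m) {a : A₁.carrier} {a' : A₂.carrier}
    (h : r (A₁.proj a) (A₂.proj a')) (k : H) :
    C.phi (m a a') k = A₁.phi a (A₂.phi a' k) := by
  refine C.phi_eq ?_
  rw [← hm.left _ _ _ h, A₁.phi_spec, hm.balanced _ _ _ h, A₂.phi_spec, hm.right _ _ _ h]

variable {EX HX : Type*} [NormedAddCommGroup EX] [NormedSpace ℝ EX] [TopologicalSpace HX]
  {IX : ModelWithCorners ℝ EX HX} {X : Type*} [TopologicalSpace X] [ChartedSpace HX X]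
  {W : Set X} {x : X}

theorem contMDiffWithinAt (hm : IsBibundleProduct r c A₁ A₂ C m) {a : X → A₁.carrier}
    {a' : X → A₂.carrier} (ha : ContMDiffWithinAt IX 𝓘(ℝ, V₁) ∞ a W x)
    (ha' : ContMDiffWithinAt IX 𝓘(ℝ, V₂) ∞ a' W x) (hx : x ∈ W)
    (h : ∀ w ∈ W, r (A₁.proj (a w)) (A₂.proj (a' w))) :
    ContMDiffWithinAt IX 𝓘(ℝ, V₃) ∞ (fun w => m (a w) (a' w)) W x :=
  ContMDiffWithinAt.comp (g := fun y : A₁.carrier × A₂.carrier => m y.1 y.2) x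
    (hm.smooth (a x, a' x) (h x hx)) (ha.prodMk ha') fun w hw => h w hw

end IsBibundleProduct

end BibundleProducts

/-! ### The right action on D-H bundles, and products with bibundles -/

section DHAlgebra

variable {VH : Type*} [NormedAddCommGroup VH] [NormedSpace ℝ VH]
  {VD : Type*} [NormedAddCommGroup VD] [NormedSpace ℝ VD]
  {H : Type u} [Group H] [TopologicalSpace H] [ChartedSpace VH H]
  {D : Type u} [Group D] [TopologicalSpace D] [ChartedSpace VD D]
  {Ξ : LieCrossedModule VH VD H D}

namespace DHBundle

variable {VB : Type*} [NormedAddCommGroup VB] [NormedSpace ℝ VB]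
  {B : Type u} [TopologicalSpace B] [ChartedSpace VB B]

section Basic

variable (Q : DHBundle Ξ VB B)

theorem proj_act (d : D) (q : Q.carrier) : Q.proj (Q.act d q) = Q.proj q :=
  Q.isPrincipal.proj_act d q

theorem proj_ract (q : Q.carrier) (h : H) : Q.proj (Q.ract q h) = Q.proj q :=
  Q.isPrincipal.proj_act _ q

theorem ract_act (d : D) (q : Q.carrier) (h : H) :
    Q.ract (Q.act d q) h = Q.act d (Q.ract q h) := by
  rw [ract, ract, Q.ψ_act, MulAut.mul_apply, Ξ.α_act, ← Q.isPrincipal.mul_act,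
    ← Q.isPrincipal.mul_act, inv_mul_cancel_right]

/-- By the Peiffer identity `act_α`, ψ at q ◁ h is ψ_q followed by conjugation with ψ_q(h); after
applying α this conjugation reverses the order of the two factors. -/
theorem ract_mul (q : Q.carrier) (h k : H) : Q.ract q (h * k) = Q.ract (Q.ract q h) k := by
  simp only [ract, Q.ψ_act, MulAut.mul_apply, Ξ.act_α, ← Q.isPrincipal.mul_act, ← map_mul]
  simp

theorem ract_one (q : Q.carrier) : Q.ract q 1 = q := by
  simp [ract, Q.isPrincipal.one_act]

theorem ψ_ract (q : Q.carrier) (h k : H) :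
    Q.ψ (Q.ract q h) k = Q.ψ q (h * k * h⁻¹) := by
  simp [ract, Q.ψ_act, Ξ.act_α]

variable {EX HX : Type*} [NormedAddCommGroup EX] [NormedSpace ℝ EX] [TopologicalSpace HX]
  {IX : ModelWithCorners ℝ EX HX} {X : Type*} [TopologicalSpace X] [ChartedSpace HX X]
  {W : Set X} {x : X}

theorem contMDiffWithinAt_ψ {q : X → Q.carrier} {h : X → H}
    (hq : ContMDiffWithinAt IX (𝓘(ℝ, VB).prod 𝓘(ℝ, VD)) ∞ q W x)
    (hh : ContMDiffWithinAt IX 𝓘(ℝ, VH) ∞ h W x) :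
    ContMDiffWithinAt IX 𝓘(ℝ, VH) ∞ (fun w => Q.ψ (q w) (h w)) W x :=
  ContMDiffAt.comp_contMDiffWithinAt (g := fun y : Q.carrier × H => Q.ψ y.1 y.2) x
    Q.smooth_ψ.contMDiffAt (hq.prodMk hh)

theorem contMDiffWithinAt_ψ_symm {q : X → Q.carrier} {h : X → H}
    (hq : ContMDiffWithinAt IX (𝓘(ℝ, VB).prod 𝓘(ℝ, VD)) ∞ q W x)
    (hh : ContMDiffWithinAt IX 𝓘(ℝ, VH) ∞ h W x) :
    ContMDiffWithinAt IX 𝓘(ℝ, VH) ∞ (fun w => (Q.ψ (q w)).symm (h w)) W x :=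
  ContMDiffAt.comp_contMDiffWithinAt (g := fun y : Q.carrier × H => (Q.ψ y.1).symm y.2) x
    Q.smooth_ψ_symm.contMDiffAt (hq.prodMk hh)

theorem contMDiffWithinAt_ract {q : X → Q.carrier} {h : X → H}
    (hq : ContMDiffWithinAt IX (𝓘(ℝ, VB).prod 𝓘(ℝ, VD)) ∞ q W x)
    (hh : ContMDiffWithinAt IX 𝓘(ℝ, VH) ∞ h W x) :
    ContMDiffWithinAt IX (𝓘(ℝ, VB).prod 𝓘(ℝ, VD)) ∞ (fun w => Q.ract (q w) (h w)) W x :=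
  Q.isPrincipal.contMDiffWithinAt_act
    (Ξ.smooth_α.contMDiffAt.comp_contMDiffWithinAt x (Q.contMDiffWithinAt_ψ hq hh)) hq

end Basic

/-- A map from a `D`-`H` bundle is smooth if it is so near points of local sections, up to the
action. -/
theorem contMDiffAt_of_section [LieGroup 𝓘(ℝ, VD) ∞ D] {Q : DHBundle Ξ VB B}
    {EX HX : Type*} [NormedAddCommGroup EX] [NormedSpace ℝ EX] [TopologicalSpace HX]
    {IX : ModelWithCorners ℝ EX HX} {X : Type*} [TopologicalSpace X] [ChartedSpace HX X]
    {f : Q.carrier → X} {U : Set B} {q : Q.carrier} {s : B → Q.carrier}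
    (hU : IsOpen U) (hq : Q.proj q ∈ U)
    (hs : ContMDiffOn 𝓘(ℝ, VB) (𝓘(ℝ, VB).prod 𝓘(ℝ, VD)) ∞ s U)
    (hp : ∀ x ∈ U, Q.proj (s x) = x)
    {F : D → B → X} (hF : ContMDiffOn (𝓘(ℝ, VD).prod 𝓘(ℝ, VB)) IX ∞
      (fun y : D × B => F y.1 y.2) (Set.univ ×ˢ U))
    (hf : ∀ d, ∀ x ∈ U, f (Q.act d (s x)) = F d x) :
    ContMDiffAt (𝓘(ℝ, VB).prod 𝓘(ℝ, VD)) IX ∞ f q := by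
  have hU' : IsOpen (Q.proj ⁻¹' U) := hU.preimage Q.isPrincipal.smooth_proj.continuous
  have h2 := hF.comp ((Q.isPrincipal.contMDiffOn_torsorDiv_section hs hp).prodMk
    Q.isPrincipal.smooth_proj.contMDiffOn) fun p hp' => ⟨trivial, hp'⟩
  refine (h2.congr fun p hp' => ?_).contMDiffAt (hU'.mem_nhds hq)
  rw [Function.comp, ← hf _ _ hp',
    Q.isPrincipal.torsorDiv_act_eq (p := p) (hp _ hp').symm]

end DHBundle

namespace IsDHProduct

variable {V₁ : Type*} [NormedAddCommGroup V₁] [NormedSpace ℝ V₁]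
  {B₁ : Type u} [TopologicalSpace B₁] [ChartedSpace V₁ B₁]
  {E₂ H₂ : Type*} [NormedAddCommGroup E₂] [NormedSpace ℝ E₂] [TopologicalSpace H₂]
  {B₂ : Type u} [TopologicalSpace B₂] [ChartedSpace H₂ B₂]
  {I₂ : ModelWithCorners ℝ E₂ H₂} {S₂ : Set B₂}
  {VA : Type*} [NormedAddCommGroup VA] [NormedSpace ℝ VA]
  {V₃ : Type*} [NormedAddCommGroup V₃] [NormedSpace ℝ V₃]
  {B₃ : Type u} [TopologicalSpace B₃] [ChartedSpace V₃ B₃]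
  {r : B₁ → B₂ → Prop} {c : B₁ → B₂ → B₃}
  {Q : DHBundle Ξ V₁ B₁} {A : Bibundle I₂ S₂ VH H VA} {C : DHBundle Ξ V₃ B₃}
  {m : Q.carrier → A.carrier → C.carrier}

/-- Right equivariance is not an axiom of `IsDHProduct`: both right actions come from α, ψ and the
action of D, and `balanced` together with `ψ_eq` matches them. -/
theorem ract_eq (hm : IsDHProduct r c Q A C m) {q : Q.carrier} {a : A.carrier}
    (hr : r (Q.proj q) (A.proj a)) (h : H) : m q (A.ract a h) = C.ract (m q a) h := by
  rw [← A.phi_spec, ← hm.balanced _ _ _ hr, DHBundle.ract, hm.map_act _ _ _ hr, DHBundle.ract,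
    hm.ψ_eq _ _ _ hr]

/-- With `a` fixed, `m` is an equivariant map of D-torsors, hence bijective on fibres; the other
half is `exists_eq`. So `IsDHProduct` need not demand bijectivity. -/
theorem injective (hm : IsDHProduct r c Q A C m) {q q' : Q.carrier} {a : A.carrier}
    (hr : r (Q.proj q) (A.proj a)) (hq : Q.proj q' = Q.proj q) (h : m q' a = m q a) : q' = q := by
  obtain ⟨d, rfl⟩ := Q.isPrincipal.exists_act_eq hq
  rw [hm.map_act _ _ _ hr] at h
  have : d = 1 := C.isPrincipal.act_injective (m q a) (by
    show C.act d _ = C.act 1 _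
    rw [h, C.isPrincipal.one_act])
  rw [this, Q.isPrincipal.one_act]

theorem exists_eq (hm : IsDHProduct r c Q A C m) {b : B₁} {a : A.carrier} {p : C.carrier}
    (hr : r b (A.proj a)) (hp : C.proj p = c b (A.proj a)) :
    ∃ q, Q.proj q = b ∧ m q a = p := by
  obtain ⟨q, rfl⟩ := Q.isPrincipal.exists_proj_eq (Set.mem_univ b)
  obtain ⟨d, hd⟩ := C.isPrincipal.exists_act_eq (hp.trans (hm.proj_eq _ _ hr).symm)
  exact ⟨Q.act d q, Q.proj_act d q, (hm.map_act _ _ _ hr).trans hd⟩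

variable {EX HX : Type*} [NormedAddCommGroup EX] [NormedSpace ℝ EX] [TopologicalSpace HX]
  {IX : ModelWithCorners ℝ EX HX} {X : Type*} [TopologicalSpace X] [ChartedSpace HX X]
  {W : Set X} {x : X}

theorem contMDiffWithinAt (hm : IsDHProduct r c Q A C m) {q : X → Q.carrier}
    {a : X → A.carrier} (hq : ContMDiffWithinAt IX (𝓘(ℝ, V₁).prod 𝓘(ℝ, VD)) ∞ q W x)
    (ha : ContMDiffWithinAt IX 𝓘(ℝ, VA) ∞ a W x) (hx : x ∈ W)
    (h : ∀ w ∈ W, r (Q.proj (q w)) (A.proj (a w))) :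
    ContMDiffWithinAt IX (𝓘(ℝ, V₃).prod 𝓘(ℝ, VD)) ∞ (fun w => m (q w) (a w)) W x :=
  ContMDiffWithinAt.comp (g := fun y : Q.carrier × A.carrier => m y.1 y.2) x
    (hm.smooth (q x, a x) (h x hx)) (hq.prodMk ha) fun w hw => h w hw

end IsDHProduct

/-- A core with a compatible family of automorphisms of `H` gives rise to a `D`-`H` bundle. -/
noncomputable def PrincipalBundleCore.toDHBundle
    {VB : Type*} [NormedAddCommGroup VB] [NormedSpace ℝ VB]
    {B : Type u} [TopologicalSpace B] [ChartedSpace VB B] [IsManifold 𝓘(ℝ, VB) ∞ B]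
    [LieGroup 𝓘(ℝ, VD) ∞ D]
    {P : Type u} {proj : P → B} {act : D → P → P}
    (Z : PrincipalBundleCore (VB := VB) (VD := VD) proj act) (Ξ : LieCrossedModule VH VD H D)
    (ψ : P → MulAut H) (ψ_act : ∀ d p, ψ (act d p) = Ξ.act d * ψ p)
    (hψ : ∀ b, ContMDiffOn (𝓘(ℝ, VB).prod 𝓘(ℝ, VH)) 𝓘(ℝ, VH) ∞
      (fun y : B × H => ψ (Z.s b y.1) y.2) (Z.U b ×ˢ Set.univ))
    (hψ' : ∀ b, ContMDiffOn (𝓘(ℝ, VB).prod 𝓘(ℝ, VH)) 𝓘(ℝ, VH) ∞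
      (fun y : B × H => (ψ (Z.s b y.1)).symm y.2) (Z.U b ×ˢ Set.univ)) :
    DHBundle Ξ VB B where
  carrier := Z.Total
  proj := Z.projection
  act := Z.action
  isPrincipal := Z.isPrincipalBundle
  ψ := ψ
  smooth_ψ y := by
    refine Z.isPrincipalBundle.contMDiffAt_of_section (f := fun p h => ψ p h) y.2 (Z.isOpen_U _)
      (Z.mem_U (Z.projection y.1)) (Z.contMDiffOn_localSection _) (Z.proj_s _) ?_
    have h : ContMDiffOn (𝓘(ℝ, VD).prod (𝓘(ℝ, VB).prod 𝓘(ℝ, VH))) 𝓘(ℝ, VH) ∞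
        (fun w : D × (B × H) => Ξ.act w.1 (ψ (Z.s (Z.projection y.1) w.2.1) w.2.2))
        (Set.univ ×ˢ (Z.U (Z.projection y.1) ×ˢ Set.univ)) :=
      Ξ.smooth_act.comp_contMDiffOn
        (contMDiffOn_fst.prodMk ((hψ _).comp contMDiffOn_snd fun w hw => hw.2))
    refine h.congr fun w _ => ?_
    exact DFunLike.congr_fun (ψ_act w.1 _) w.2.2
  smooth_ψ_symm y := by
    refine Z.isPrincipalBundle.contMDiffAt_of_section (f := fun p h => (ψ p).symm h) y.2
      (Z.isOpen_U _) (Z.mem_U (Z.projection y.1)) (Z.contMDiffOn_localSection _) (Z.proj_s _) ?_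
    -- The inverse of ψ at d s(x) is ψ_{s(x)}⁻¹ after the action of d⁻¹, so smoothness reduces to
    -- the section.
    have h0 : ContMDiffOn (𝓘(ℝ, VD).prod (𝓘(ℝ, VB).prod 𝓘(ℝ, VH))) 𝓘(ℝ, VH) ∞
        (fun w : D × (B × H) => Ξ.act w.1⁻¹ w.2.2)
        (Set.univ ×ˢ (Z.U (Z.projection y.1) ×ˢ Set.univ)) :=
      Ξ.smooth_act.comp_contMDiffOn (contMDiffOn_fst.inv.prodMk (contMDiff_snd.comp contMDiff_snd).contMDiffOn)
    have h : ContMDiffOn (𝓘(ℝ, VD).prod (𝓘(ℝ, VB).prod 𝓘(ℝ, VH))) 𝓘(ℝ, VH) ∞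
        (fun w : D × (B × H) => (ψ (Z.s (Z.projection y.1) w.2.1)).symm (Ξ.act w.1⁻¹ w.2.2))
        (Set.univ ×ˢ (Z.U (Z.projection y.1) ×ˢ Set.univ)) :=
      (hψ' (Z.projection y.1)).comp ((contMDiff_fst.comp contMDiff_snd).contMDiffOn.prodMk h0) fun w hw => ⟨hw.2.1, trivial⟩
    refine h.congr fun w _ => ?_
    refine (MulEquiv.symm_apply_eq _).2 ?_
    have h1 : ψ (Z.action w.1 (Z.localSection (Z.projection y.1) w.2.1)) =
      Ξ.act w.1 * ψ (Z.s (Z.projection y.1) w.2.1) := ψ_act w.1 _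
    rw [h1, MulAut.mul_apply, MulEquiv.apply_symm_apply, ← MulAut.mul_apply, ← map_mul]
    simp
  ψ_act := ψ_act

end DHAlgebra

/-! ### Computing with β and with the module structure -/

section Modules

variable {VM : Type*} [NormedAddCommGroup VM] [NormedSpace ℝ VM]
  {VY : Type*} [NormedAddCommGroup VY] [NormedSpace ℝ VY]
  {VH : Type*} [NormedAddCommGroup VH] [NormedSpace ℝ VH]
  {VD : Type*} [NormedAddCommGroup VD] [NormedSpace ℝ VD]
  {VE : Type*} [NormedAddCommGroup VE] [NormedSpace ℝ VE]
  {VN : Type*} [NormedAddCommGroup VN] [NormedSpace ℝ VN]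
  {M : Type u} {Y : Type u} [TopologicalSpace Y] [ChartedSpace VY Y]
  {H : Type u} [Group H] [TopologicalSpace H] [ChartedSpace VH H]
  {D : Type u} [Group D] [TopologicalSpace D] [ChartedSpace VD D]
  {Ξ : LieCrossedModule VH VD H D} {℘ : Y → M} {𝒢 : BundleGerbe VY ℘ VH H VE}

namespace BundleGerbe.Trivialization

variable (𝒯 : 𝒢.Trivialization VN) {n n' : 𝒯.N.carrier}

theorem proj_β (h : ℘ (𝒯.N.proj n) = ℘ (𝒯.N.proj n')) :
    𝒢.E.proj (𝒯.β n n') = (𝒯.N.proj n, 𝒯.N.proj n') :=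
  𝒯.isProduct_β.proj_eq n n' h

/-- In the inverse bibundle (k n)⁻¹ = n⁻¹ ◁ k⁻¹; the next lemma likewise uses (n ◁ k)⁻¹ = k⁻¹ n⁻¹.
-/
theorem β_lact_left (h : ℘ (𝒯.N.proj n) = ℘ (𝒯.N.proj n')) (k : H) :
    𝒯.β (𝒯.N.lact k n) n' = 𝒯.β n (𝒯.N.lact k⁻¹ n') := by
  rw [← 𝒯.isProduct_β.balanced n n' k⁻¹ h]
  show _ = 𝒯.β (𝒯.N.lact k⁻¹⁻¹ n) n'
  rw [inv_inv]

theorem β_ract_left (h : ℘ (𝒯.N.proj n) = ℘ (𝒯.N.proj n')) (k : H) :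
    𝒯.β (𝒯.N.ract n k) n' = 𝒢.E.lact k⁻¹ (𝒯.β n n') := by
  rw [← 𝒯.isProduct_β.left k⁻¹ n n' h]
  show _ = 𝒯.β (𝒯.N.ract n k⁻¹⁻¹) n'
  rw [inv_inv]

theorem β_ract (h : ℘ (𝒯.N.proj n) = ℘ (𝒯.N.proj n')) (k : H) :
    𝒯.β n (𝒯.N.ract n' k) = 𝒢.E.ract (𝒯.β n n') k :=
  𝒯.isProduct_β.right n n' k h

theorem phi_β (h : ℘ (𝒯.N.proj n) = ℘ (𝒯.N.proj n')) (k : H) :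
    𝒢.E.phi (𝒯.β n n') k = 𝒯.N.inv.phi n (𝒯.N.phi n' k) :=
  𝒯.isProduct_β.phi_eq h k

theorem β_injective {n'' : 𝒯.N.carrier} (h' : ℘ (𝒯.N.proj n) = ℘ (𝒯.N.proj n'))
    (h'' : ℘ (𝒯.N.proj n) = ℘ (𝒯.N.proj n'')) (h : 𝒯.β n n' = 𝒯.β n n'') : n' = n'' := by
  have hproj : 𝒯.N.proj n' = 𝒯.N.proj n'' := by
    have := congrArg 𝒢.E.proj h
    rw [𝒯.proj_β h', 𝒯.proj_β h''] at this
    exact congrArg Prod.snd this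
  obtain ⟨k, rfl⟩ := 𝒯.N.exists_ract_eq hproj
  rw [𝒯.β_ract h''] at h
  have hk : k⁻¹ = 1 := 𝒢.E.isRight.act_injective (𝒯.β n n'') (by
    show 𝒢.E.ract _ k⁻¹⁻¹ = 𝒢.E.ract _ 1⁻¹
    rw [inv_inv, h, inv_one, 𝒢.E.ract_one])
  rw [inv_eq_one.1 hk, 𝒯.N.ract_one]

/-- Surjectivity of β with its first argument fixed, by transitivity of the right action on 𝓔. It
allows arbitrary `e` to be replaced by values of β. -/
theorem exists_β_eq {e : 𝒢.E.carrier} (h : (𝒢.E.proj e).1 = 𝒯.N.proj n) :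
    ∃ n', 𝒯.N.proj n' = (𝒢.E.proj e).2 ∧ ℘ (𝒯.N.proj n) = ℘ (𝒯.N.proj n') ∧ 𝒯.β n n' = e := by
  obtain ⟨n₁, hn₁⟩ := 𝒯.N.isLeft.exists_proj_eq (Set.mem_univ (𝒢.E.proj e).2)
  have h₁ : ℘ (𝒯.N.proj n) = ℘ (𝒯.N.proj n₁) := by
    rw [hn₁, ← h]
    exact 𝒢.E.isLeft.proj_mem e
  obtain ⟨k, hk⟩ := 𝒢.E.exists_ract_eq (e := e) (e' := 𝒯.β n n₁)
    (by rw [𝒯.proj_β h₁, hn₁, ← h])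
  refine ⟨𝒯.N.ract n₁ k, ?_, ?_, ?_⟩
  · rw [𝒯.N.proj_ract, hn₁]
  · rw [𝒯.N.proj_ract, h₁]
  · rw [𝒯.β_ract h₁, hk]

variable {EX HX : Type*} [NormedAddCommGroup EX] [NormedSpace ℝ EX] [TopologicalSpace HX]
  {IX : ModelWithCorners ℝ EX HX} {X : Type*} [TopologicalSpace X] [ChartedSpace HX X]
  {W : Set X} {x : X}

theorem contMDiffWithinAt_β {n n' : X → 𝒯.N.carrier}
    (hn : ContMDiffWithinAt IX 𝓘(ℝ, VN) ∞ n W x) (hn' : ContMDiffWithinAt IX 𝓘(ℝ, VN) ∞ n' W x)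
    (hx : x ∈ W) (h : ∀ w ∈ W, ℘ (𝒯.N.proj (n w)) = ℘ (𝒯.N.proj (n' w))) :
    ContMDiffWithinAt IX 𝓘(ℝ, VE) ∞ (fun w => 𝒯.β (n w) (n' w)) W x :=
  𝒯.isProduct_β.contMDiffWithinAt (a := n) hn hn' hx h

/-- Near each point of `M` there are compatible local sections of `𝓝` and of a given bundle
over `Y`. -/
theorem exists_section [TopologicalSpace M] [ChartedSpace VM M]
    (h_surj : Function.Surjective ℘)
    (h_subm : Manifold.IsSubmersion 𝓘(ℝ, VY) 𝓘(ℝ, VM) ∞ ℘) (Q : DHBundle Ξ VY Y) (b : M) :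
    ∃ U : Set M, IsOpen U ∧ b ∈ U ∧ ∃ (n : M → 𝒯.N.carrier) (q : M → Q.carrier),
      ContMDiffOn 𝓘(ℝ, VM) 𝓘(ℝ, VN) ∞ n U ∧
      ContMDiffOn 𝓘(ℝ, VM) (𝓘(ℝ, VY).prod 𝓘(ℝ, VD)) ∞ q U ∧
      (∀ x ∈ U, ℘ (𝒯.N.proj (n x)) = x) ∧ ∀ x ∈ U, Q.proj (q x) = 𝒯.N.proj (n x) := by
  obtain ⟨y, rfl⟩ := h_surj b
  obtain ⟨U, hU, hb, σ, hσ, hσ'⟩ := (h_subm.isSubmersionAt y).exists_section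
  obtain ⟨V, hV, hy, n, hn, hn'⟩ := 𝒯.N.isLeft.exists_section (σ (℘ y))
  obtain ⟨V', hV', hy', q, hq, hq'⟩ := Q.isPrincipal.exists_section (σ (℘ y))
  refine ⟨U ∩ σ ⁻¹' (V ∩ V'), hσ.continuousOn.isOpen_inter_preimage hU (hV.inter hV'),
    ⟨hb, hy, hy'⟩, fun x => n (σ x), fun x => q (σ x), ?_, ?_, ?_, ?_⟩
  · exact hn.comp (hσ.mono Set.inter_subset_left) fun x hx => hx.2.1
  · exact hq.comp (hσ.mono Set.inter_subset_left) fun x hx => hx.2.2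
  · intro x hx
    rw [hn' _ hx.2.1, hσ' _ hx.1]
  · intro x hx
    rw [hn' _ hx.2.1, hq' _ hx.2.2]

end BundleGerbe.Trivialization

namespace GerbeModule

variable (K : GerbeModule Ξ 𝒢) (𝒯 : 𝒢.Trivialization VN)

theorem proj_z {q : K.Q.carrier} {e : 𝒢.E.carrier} (h : K.Q.proj q = (𝒢.E.proj e).1) :
    K.Q.proj (K.z q e) = (𝒢.E.proj e).2 :=
  K.isProduct_z.proj_eq q e h

theorem z_act {q : K.Q.carrier} {e : 𝒢.E.carrier} (h : K.Q.proj q = (𝒢.E.proj e).1) (d : D) :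
    K.z (K.Q.act d q) e = K.Q.act d (K.z q e) :=
  K.isProduct_z.map_act d q e h

variable {𝒯} {q : K.Q.carrier} {n n' n'' : 𝒯.N.carrier}

theorem proj_eq_proj_β (hq : K.Q.proj q = 𝒯.N.proj n) (h : ℘ (𝒯.N.proj n) = ℘ (𝒯.N.proj n')) :
    K.Q.proj q = (𝒢.E.proj (𝒯.β n n')).1 := by
  rw [𝒯.proj_β h, hq]

theorem proj_z_β (hq : K.Q.proj q = 𝒯.N.proj n) (h : ℘ (𝒯.N.proj n) = ℘ (𝒯.N.proj n')) :
    K.Q.proj (K.z q (𝒯.β n n')) = 𝒯.N.proj n' := by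
  rw [K.proj_z (K.proj_eq_proj_β hq h), 𝒯.proj_β h]

/-- The maps q ↦ z(q, β(n, n')) act as a parallel transport from n to n'; this is their cocycle
identity. -/
theorem z_z_β (hq : K.Q.proj q = 𝒯.N.proj n) (h : ℘ (𝒯.N.proj n) = ℘ (𝒯.N.proj n'))
    (h' : ℘ (𝒯.N.proj n') = ℘ (𝒯.N.proj n'')) :
    K.z (K.z q (𝒯.β n n')) (𝒯.β n' n'') = K.z q (𝒯.β n n'') := by
  rw [K.compat q _ _ (K.proj_eq_proj_β hq h) (by rw [𝒯.proj_β h, 𝒯.proj_β h']), 𝒯.f_β _ _ _ h h']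

/-- ψ_q φ_n⁻¹, the value of ψ at [q, n⁻¹], is invariant under the transport, hence descends to M. -/
theorem ψ_z_β (hq : K.Q.proj q = 𝒯.N.proj n) (h : ℘ (𝒯.N.proj n) = ℘ (𝒯.N.proj n')) :
    K.Q.ψ (K.z q (𝒯.β n n')) * (𝒯.N.phiAut n')⁻¹ = K.Q.ψ q * (𝒯.N.phiAut n)⁻¹ := by
  rw [mul_inv_eq_iff_eq_mul]
  ext k
  rw [K.isProduct_z.ψ_eq _ _ _ (K.proj_eq_proj_β hq h), 𝒯.phi_β h]
  rfl

variable {EX HX : Type*} [NormedAddCommGroup EX] [NormedSpace ℝ EX] [TopologicalSpace HX]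
  {IX : ModelWithCorners ℝ EX HX} {X : Type*} [TopologicalSpace X] [ChartedSpace HX X]
  {W : Set X} {x : X}

theorem contMDiffWithinAt_z_β {q : X → K.Q.carrier} {n n' : X → 𝒯.N.carrier}
    (hq : ContMDiffWithinAt IX (𝓘(ℝ, VY).prod 𝓘(ℝ, VD)) ∞ q W x)
    (hn : ContMDiffWithinAt IX 𝓘(ℝ, VN) ∞ n W x) (hn' : ContMDiffWithinAt IX 𝓘(ℝ, VN) ∞ n' W x)
    (hx : x ∈ W) (h : ∀ w ∈ W, K.Q.proj (q w) = 𝒯.N.proj (n w))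
    (h' : ∀ w ∈ W, ℘ (𝒯.N.proj (n w)) = ℘ (𝒯.N.proj (n' w))) :
    ContMDiffWithinAt IX (𝓘(ℝ, VY).prod 𝓘(ℝ, VD)) ∞
      (fun w => K.z (q w) (𝒯.β (n w) (n' w))) W x :=
  K.isProduct_z.contMDiffWithinAt hq (𝒯.contMDiffWithinAt_β hn hn' hx h') hx
    fun w hw => K.proj_eq_proj_β (h w hw) (h' w hw)

end GerbeModule

end Modules

/-! ### Descent of 𝓠𝓝⁻¹ to M -/

section Descent

variable {VM : Type*} [NormedAddCommGroup VM] [NormedSpace ℝ VM]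
  {VY : Type*} [NormedAddCommGroup VY] [NormedSpace ℝ VY]
  {VH : Type*} [NormedAddCommGroup VH] [NormedSpace ℝ VH]
  {VD : Type*} [NormedAddCommGroup VD] [NormedSpace ℝ VD]
  {VE : Type*} [NormedAddCommGroup VE] [NormedSpace ℝ VE]
  {VN : Type*} [NormedAddCommGroup VN] [NormedSpace ℝ VN]
  {M : Type u} [TopologicalSpace M] [ChartedSpace VM M] [IsManifold 𝓘(ℝ, VM) ∞ M]
  {Y : Type u} [TopologicalSpace Y] [ChartedSpace VY Y]
  {H : Type u} [Group H] [TopologicalSpace H] [ChartedSpace VH H] [LieGroup 𝓘(ℝ, VH) ∞ H]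
  {D : Type u} [Group D] [TopologicalSpace D] [ChartedSpace VD D] [LieGroup 𝓘(ℝ, VD) ∞ D]
  {Ξ : LieCrossedModule VH VD H D} {℘ : Y → M} {𝒢 : BundleGerbe VY ℘ VH H VE}

/-- For every module `𝓠`, the bundle `𝓠 𝓝⁻¹` descends to `M`. -/
theorem GerbeModule.exists_isDescent (K : GerbeModule Ξ 𝒢) (𝒯 : 𝒢.Trivialization VN)
    (h_surj : Function.Surjective ℘)
    (h_subm : Manifold.IsSubmersion 𝓘(ℝ, VY) 𝓘(ℝ, VM) ∞ ℘) :
    ∃ (P : DHBundle Ξ VM M) (δ : K.Q.carrier → 𝒯.N.carrier → P.carrier),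
      IsDescent 𝒯 K P δ := by
  classical
  have hn₀ : ∀ x, ∃ n : 𝒯.N.carrier, ℘ (𝒯.N.proj n) = x := fun x => by
    obtain ⟨y, rfl⟩ := h_surj x
    obtain ⟨n, rfl⟩ := 𝒯.N.isLeft.exists_proj_eq (Set.mem_univ y)
    exact ⟨n, rfl⟩
  choose n₀ hn₀ using hn₀
  -- A point q of `T` over x stands for the class [q, n₀(x)⁻¹]; any [q, n⁻¹] is brought to this form
  -- by transporting q from n to n₀.
  let T : Type u := {q : K.Q.carrier // K.Q.proj q = 𝒯.N.proj (n₀ (℘ (K.Q.proj q)))}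
  let π : T → M := fun p => ℘ (K.Q.proj p.1)
  let act : D → T → T := fun d p => ⟨K.Q.act d p.1, by rw [K.Q.proj_act]; exact p.2⟩
  have hT : ∀ {q n}, K.Q.proj q = 𝒯.N.proj n →
      K.Q.proj (K.z q (𝒯.β n (n₀ (℘ (𝒯.N.proj n))))) = 𝒯.N.proj (n₀ (℘
        (K.Q.proj (K.z q (𝒯.β n (n₀ (℘ (𝒯.N.proj n)))))))) := fun {q n} h => by
    rw [K.proj_z_β h (hn₀ _).symm, hn₀]
  -- A default for δ off the fibre product. It takes `n` as an argument because `T` is empty when Y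
  -- is.
  have hne : Nonempty (𝒯.N.carrier → T) := ⟨fun n => by
    have h := K.Q.isPrincipal.exists_proj_eq (Set.mem_univ (𝒯.N.proj n))
    exact ⟨_, hT h.choose_spec⟩⟩
  obtain ⟨junk⟩ := hne
  let δ : K.Q.carrier → 𝒯.N.carrier → T := fun q n =>
    if h : K.Q.proj q = 𝒯.N.proj n then ⟨_, hT h⟩ else junk n
  have δ_val : ∀ {q n}, K.Q.proj q = 𝒯.N.proj n →
      (δ q n).1 = K.z q (𝒯.β n (n₀ (℘ (𝒯.N.proj n)))) := fun h => by simp only [δ, dif_pos h]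
  have π_δ : ∀ {q n}, K.Q.proj q = 𝒯.N.proj n → π (δ q n) = ℘ (𝒯.N.proj n) := fun {q n} h => by
    show ℘ (K.Q.proj (δ q n).1) = _
    rw [δ_val h, K.proj_z_β h (hn₀ _).symm, hn₀]
  have δ_act : ∀ {q n}, K.Q.proj q = 𝒯.N.proj n → ∀ d,
      δ (K.Q.act d q) n = act d (δ q n) := fun {q n} h d => by
    refine Subtype.ext ?_
    rw [δ_val ((K.Q.proj_act d q).trans h), K.z_act (K.proj_eq_proj_β h (hn₀ _).symm), ← δ_val h]
  have δ_z : ∀ {q n n'}, K.Q.proj q = 𝒯.N.proj n → ℘ (𝒯.N.proj n) = ℘ (𝒯.N.proj n') →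
      δ (K.z q (𝒯.β n n')) n' = δ q n := fun {q n n'} h h' => by
    refine Subtype.ext ?_
    rw [δ_val (K.proj_z_β h h'), δ_val h, K.z_z_β h h' (hn₀ _).symm, h']
  have δ_ract : ∀ {q n}, K.Q.proj q = 𝒯.N.proj n → ∀ k,
      δ (K.Q.ract q k) n = δ q (𝒯.N.ract n k⁻¹) := fun {q n} h k => by
    refine Subtype.ext ?_
    rw [δ_val ((K.Q.proj_ract q k).trans h), δ_val (by rwa [𝒯.N.proj_ract]), 𝒯.N.proj_ract,
      𝒯.β_ract_left (hn₀ _).symm, inv_inv,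
      K.isProduct_z.balanced _ _ _ (K.proj_eq_proj_β h (hn₀ _).symm)]
  let ψ : T → MulAut H := fun p => K.Q.ψ p.1 * (𝒯.N.phiAut (n₀ (π p)))⁻¹
  have ψ_δ : ∀ {q n}, K.Q.proj q = 𝒯.N.proj n →
      ψ (δ q n) = K.Q.ψ q * (𝒯.N.phiAut n)⁻¹ := fun {q n} h => by
    show K.Q.ψ (δ q n).1 * (𝒯.N.phiAut (n₀ (π (δ q n))))⁻¹ = _
    rw [δ_val h, π_δ h, K.ψ_z_β h (hn₀ _).symm]
  -- ν and κ are sections of 𝓝 and 𝓠 over one and the same local section of ℘, so δ(κ, ν) is a local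
  -- section of the descended bundle.
  choose U hU hbU ν κ hν hκ hν' hκ' using 𝒯.exists_section h_surj h_subm K.Q
  let Z : PrincipalBundleCore (VB := VM) (VD := VD) π act :=
    { one_act := fun p => Subtype.ext (K.Q.isPrincipal.one_act p.1)
      mul_act := fun g g' p => Subtype.ext (K.Q.isPrincipal.mul_act g g' p.1)
      proj_act := fun g p => congrArg ℘ (K.Q.proj_act g p.1)
      act_injective := fun p g g' h =>
        K.Q.isPrincipal.act_injective p.1 (congrArg Subtype.val h)
      exists_act_eq := fun p q h => by
        obtain ⟨g, hg⟩ := K.Q.isPrincipal.exists_act_eq (p := p.1) (q := q.1) (by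
          rw [p.2, q.2]
          exact congrArg (fun x => 𝒯.N.proj (n₀ x)) h)
        exact ⟨g, Subtype.ext hg⟩
      U := U
      isOpen_U := hU
      mem_U := hbU
      s := fun b x => δ (κ b x) (ν b x)
      proj_s := fun b x hx => (π_δ (hκ' b x hx)).trans (hν' b x hx)
      -- By `δ_z`, δ(κ_b, ν_b) is δ at ν_b' of κ_b transported from ν_b to ν_b'. Its quotient by
      -- κ_b' is the transition function; the discontinuous `n₀` has dropped out.
      exists_transition := fun b b' => by
        have h1 : ∀ x ∈ U b ∩ U b', ℘ (𝒯.N.proj (ν b x)) = ℘ (𝒯.N.proj (ν b' x)) := fun x hx => by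
          rw [hν' b x hx.1, hν' b' x hx.2]
        have h2 : ∀ x ∈ U b ∩ U b', K.Q.proj (K.z (κ b x) (𝒯.β (ν b x) (ν b' x))) =
            K.Q.proj (κ b' x) := fun x hx => by
          rw [K.proj_z_β (hκ' b x hx.1) (h1 x hx), hκ' b' x hx.2]
        refine ⟨fun x => torsorDiv K.Q.act (K.z (κ b x) (𝒯.β (ν b x) (ν b' x))) (κ b' x),
          fun x hx => ?_, fun x hx => ?_⟩
        · exact K.Q.isPrincipal.contMDiffWithinAt_torsorDiv
            (K.contMDiffWithinAt_z_β ((hκ b).mono Set.inter_subset_left x hx)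
              ((hν b).mono Set.inter_subset_left x hx) ((hν b').mono Set.inter_subset_right x hx)
              hx (fun w hw => hκ' b w hw.1) h1)
            ((hκ b').mono Set.inter_subset_right x hx) hx h2
        · rw [← δ_act (hκ' b' x hx.2), K.Q.isPrincipal.torsorDiv_act_eq (h2 x hx),
            δ_z (hκ' b x hx.1) (h1 x hx)] }
  let P : DHBundle Ξ VM M := Z.toDHBundle Ξ ψ
    (fun d p => by
      show K.Q.ψ (K.Q.act d p.1) * (𝒯.N.phiAut (n₀ (π (act d p))))⁻¹ = _
      rw [K.Q.ψ_act, Z.proj_act, mul_assoc])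
    (fun b y hy => by
      have h : ContMDiffWithinAt (𝓘(ℝ, VM).prod 𝓘(ℝ, VH)) 𝓘(ℝ, VH) ∞
          (fun y : M × H => K.Q.ψ (κ b y.1) (𝒯.N.inv.phi (ν b y.1) y.2)) (U b ×ˢ Set.univ) y :=
        K.Q.contMDiffWithinAt_ψ ((hκ b).comp contMDiffOn_fst (fun w hw => hw.1) y hy)
          (𝒯.N.inv.contMDiffWithinAt_phi ((hν b).comp contMDiffOn_fst (fun w hw => hw.1) y hy)
            contMDiffWithinAt_snd hy)
      exact h.congr_of_mem (fun w hw => DFunLike.congr_fun (ψ_δ (hκ' b w.1 hw.1)) w.2) hy)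
    (fun b y hy => by
      have h : ContMDiffWithinAt (𝓘(ℝ, VM).prod 𝓘(ℝ, VH)) 𝓘(ℝ, VH) ∞
          (fun y : M × H => 𝒯.N.phi (ν b y.1) ((K.Q.ψ (κ b y.1)).symm y.2)) (U b ×ˢ Set.univ) y :=
        𝒯.N.contMDiffWithinAt_phi ((hν b).comp contMDiffOn_fst (fun w hw => hw.1) y hy)
          (K.Q.contMDiffWithinAt_ψ_symm ((hκ b).comp contMDiffOn_fst (fun w hw => hw.1) y hy)
            contMDiffWithinAt_snd) hy
      exact h.congr_of_mem (fun w hw => congrArg (fun e : MulAut H => e.symm w.2)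
        (ψ_δ (hκ' b w.1 hw.1))) hy)
  refine ⟨P, δ, ⟨?_, fun q n h => ?_, fun q n k h => ?_, fun d q n h => δ_act h d,
    fun q n k h => DFunLike.congr_fun (ψ_δ h) k⟩, fun q n n' h h' => δ_z h h'⟩
  -- Near (q, n), δ is the section s_b at ℘(n) acted on by a quotient: that of q, transported from n
  -- to ν_b, by κ_b. Here too `n₀` is absent.
  · rintro ⟨q, n⟩ (h : K.Q.proj q = 𝒯.N.proj n)
    let b := ℘ (𝒯.N.proj n)
    let R : Set (K.Q.carrier × 𝒯.N.carrier) := {w | K.Q.proj w.1 = 𝒯.N.proj w.2}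
    let p : K.Q.carrier × 𝒯.N.carrier → M := fun w => ℘ (𝒯.N.proj w.2)
    have hp : ContMDiff ((𝓘(ℝ, VY).prod 𝓘(ℝ, VD)).prod 𝓘(ℝ, VN)) 𝓘(ℝ, VM) ∞ p :=
      h_subm.contMDiff.comp (𝒯.N.isLeft.smooth_proj.comp contMDiff_snd)
    have hO : IsOpen (p ⁻¹' U b) := (hU b).preimage hp.continuous
    have hx : (q, n) ∈ R ∩ p ⁻¹' U b := ⟨h, hbU b⟩
    have hmaps : Set.MapsTo p (R ∩ p ⁻¹' U b) (U b) := fun w hw => hw.2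
    have h1 : ∀ w ∈ R ∩ p ⁻¹' U b, ℘ (𝒯.N.proj w.2) = ℘ (𝒯.N.proj (ν b (p w))) :=
      fun w hw => (hν' b (p w) hw.2).symm
    have h2 : ∀ w ∈ R ∩ p ⁻¹' U b,
        K.Q.proj (K.z w.1 (𝒯.β w.2 (ν b (p w)))) = K.Q.proj (κ b (p w)) := fun w hw => by
      rw [K.proj_z_β hw.1 (h1 w hw), hκ' b _ hw.2]
    have hκp := (hκ b).comp hp.contMDiffOn hmaps (q, n) hx
    have hνp := (hν b).comp hp.contMDiffOn hmaps (q, n) hx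
    have hs := Z.contMDiffOn_localSection b |>.comp hp.contMDiffOn hmaps (q, n) hx
    have key := Z.isPrincipalBundle.contMDiffWithinAt_act
      (K.Q.isPrincipal.contMDiffWithinAt_torsorDiv
        (K.contMDiffWithinAt_z_β contMDiffWithinAt_fst contMDiffWithinAt_snd hνp hx
          (fun w hw => hw.1) h1) hκp hx h2) hs
    refine (key.congr_of_mem (fun w hw => ?_) hx).mono_of_mem_nhdsWithin
      (Filter.inter_mem self_mem_nhdsWithin (mem_nhdsWithin_of_mem_nhds (hO.mem_nhds hx.2)))
    refine Eq.trans (δ_z hw.1 (h1 w hw)).symm ?_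
    have := δ_act (hκ' b _ hw.2) (torsorDiv K.Q.act (K.z w.1 (𝒯.β w.2 (ν b (p w)))) (κ b (p w)))
    rw [K.Q.isPrincipal.torsorDiv_act_eq (h2 w hw)] at this
    exact this
  · exact (π_δ h).trans (congrArg ℘ h.symm)
  · exact δ_ract h k

end Descent

/-! ### The module ℘^*(P)𝓝 -/

section Twist

variable {VM : Type*} [NormedAddCommGroup VM] [NormedSpace ℝ VM]
  {VY : Type*} [NormedAddCommGroup VY] [NormedSpace ℝ VY]
  {VH : Type*} [NormedAddCommGroup VH] [NormedSpace ℝ VH]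
  {VD : Type*} [NormedAddCommGroup VD] [NormedSpace ℝ VD]
  {VE : Type*} [NormedAddCommGroup VE] [NormedSpace ℝ VE]
  {VN : Type*} [NormedAddCommGroup VN] [NormedSpace ℝ VN]
  {M : Type u} [TopologicalSpace M] [ChartedSpace VM M]
  {Y : Type u} [TopologicalSpace Y] [ChartedSpace VY Y] [IsManifold 𝓘(ℝ, VY) ∞ Y]
  {H : Type u} [Group H] [TopologicalSpace H] [ChartedSpace VH H] [LieGroup 𝓘(ℝ, VH) ∞ H]
  {D : Type u} [Group D] [TopologicalSpace D] [ChartedSpace VD D] [LieGroup 𝓘(ℝ, VD) ∞ D]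
  {Ξ : LieCrossedModule VH VD H D} {℘ : Y → M}

/-- The product `℘^*(P) N` of the pull-back of a `D`-`H` bundle and a bibundle exists. -/
theorem DHBundle.exists_isDHProduct_pullback (P : DHBundle Ξ VM M)
    (N : Bibundle 𝓘(ℝ, VY) (Set.univ : Set Y) VH H VN)
    (h℘ : ContMDiff 𝓘(ℝ, VY) 𝓘(ℝ, VM) ∞ ℘) :
    ∃ (Q : DHBundle Ξ VY Y) (ε : P.carrier → N.carrier → Q.carrier),
      IsDHProduct (fun x y => x = ℘ y) (fun _ y => y) P N Q ε := by
  classical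
  have hn₀ : ∀ y, ∃ n : N.carrier, N.proj n = y := fun y =>
    N.isLeft.exists_proj_eq (Set.mem_univ y)
  choose n₀ hn₀ using hn₀
  -- A pair (y, p) stands for [p, n₀(y)]. Since n = k₀(n) n₀(y), the normal form of [p, n] is p ◁
  -- k₀(n).
  let T : Type u := {p : Y × P.carrier // P.proj p.2 = ℘ p.1}
  let π : T → Y := fun p => p.1.1
  let act : D → T → T := fun d p => ⟨(p.1.1, P.act d p.1.2), by rw [P.proj_act]; exact p.2⟩
  let k₀ : N.carrier → H := fun n => torsorDiv N.lact n (n₀ (N.proj n))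
  have hk₀ : ∀ n, N.lact (k₀ n) (n₀ (N.proj n)) = n := fun n =>
    N.isLeft.torsorDiv_act_eq (hn₀ _).symm
  have k₀_lact : ∀ k n, k₀ (N.lact k n) = k * k₀ n := fun k n => by
    refine N.isLeft.torsorDiv_eq ?_
    rw [N.proj_lact, N.isLeft.mul_act, hk₀]
  have hne : Nonempty (N.carrier → T) := ⟨fun n => by
    have h := P.isPrincipal.exists_proj_eq (Set.mem_univ (℘ (N.proj n)))
    exact ⟨(N.proj n, h.choose), h.choose_spec⟩⟩
  obtain ⟨junk⟩ := hne
  let ε : P.carrier → N.carrier → T := fun p n =>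
    if h : P.proj p = ℘ (N.proj n) then
      ⟨(N.proj n, P.ract p (k₀ n)), by rw [P.proj_ract, h]⟩ else junk n
  have ε_val : ∀ {p n}, P.proj p = ℘ (N.proj n) →
      (ε p n).1 = (N.proj n, P.ract p (k₀ n)) := fun h => by simp only [ε, dif_pos h]
  have π_ε : ∀ {p n}, P.proj p = ℘ (N.proj n) → π (ε p n) = N.proj n := fun h =>
    congrArg Prod.fst (ε_val h)
  have ε_act : ∀ {p n}, P.proj p = ℘ (N.proj n) → ∀ d,
      ε (P.act d p) n = act d (ε p n) := fun {p n} h d => by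
    refine Subtype.ext ?_
    show _ = ((ε p n).1.1, P.act d (ε p n).1.2)
    rw [ε_val ((P.proj_act d p).trans h), ε_val h, P.ract_act]
  have ε_ract : ∀ {p n}, P.proj p = ℘ (N.proj n) → ∀ k,
      ε (P.ract p k) n = ε p (N.lact k n) := fun {p n} h k => by
    refine Subtype.ext ?_
    rw [ε_val ((P.proj_ract p k).trans h), ε_val (h.trans (by rw [N.proj_lact])), N.proj_lact,
      k₀_lact, P.ract_mul]
  let ψ : T → MulAut H := fun p => P.ψ p.1.2 * N.phiAut (n₀ p.1.1)
  -- Independence of `n₀`: passing from n₀ to n = k₀ n₀ conjugates φ by k₀, and ψ at p ◁ k₀ is ψ_p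
  -- precomposed with the same conjugation.
  have ψ_ε : ∀ {p n}, P.proj p = ℘ (N.proj n) → ψ (ε p n) = P.ψ p * N.phiAut n :=
    fun {p n} h => by
    show P.ψ (ε p n).1.2 * N.phiAut (n₀ (ε p n).1.1) = _
    rw [ε_val h]
    ext l
    show P.ψ (P.ract p (k₀ n)) (N.phi (n₀ (N.proj n)) l) = P.ψ p (N.phi n l)
    rw [P.ψ_ract]
    congr 1
    refine (N.phi_eq ?_).symm
    have h' : N.lact (k₀ n * N.phi (n₀ (N.proj n)) l * (k₀ n)⁻¹) (N.lact (k₀ n) (n₀ (N.proj n))) =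
        N.ract (N.lact (k₀ n) (n₀ (N.proj n))) l := by
      rw [← N.isLeft.mul_act, inv_mul_cancel_right, N.isLeft.mul_act, N.phi_spec, N.comm]
    rwa [hk₀] at h'
  have hsec : ∀ y : Y, ∃ U : Set Y, IsOpen U ∧ y ∈ U ∧ ∃ (n : Y → N.carrier) (p : Y → P.carrier),
      ContMDiffOn 𝓘(ℝ, VY) 𝓘(ℝ, VN) ∞ n U ∧
      ContMDiffOn 𝓘(ℝ, VY) (𝓘(ℝ, VM).prod 𝓘(ℝ, VD)) ∞ p U ∧
      (∀ x ∈ U, N.proj (n x) = x) ∧ ∀ x ∈ U, P.proj (p x) = ℘ (N.proj (n x)) := fun y => by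
    obtain ⟨V, hV, hy, n, hn, hn'⟩ := N.isLeft.exists_section y
    obtain ⟨V', hV', hy', p, hp, hp'⟩ := P.isPrincipal.exists_section (℘ y)
    refine ⟨V ∩ ℘ ⁻¹' V', hV.inter (hV'.preimage h℘.continuous), ⟨hy, hy'⟩, n, fun y => p (℘ y),
      hn.mono Set.inter_subset_left, hp.comp h℘.contMDiffOn fun x hx => hx.2,
      fun x hx => hn' x hx.1, fun x hx => ?_⟩
    rw [hp' _ hx.2, hn' x hx.1]
  choose U hU hbU ν κ hν hκ hν' hκ' using hsec
  have h1 : ∀ b b', ∀ x ∈ U b ∩ U b', N.proj (ν b x) = N.proj (ν b' x) := fun b b' x hx => by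
    rw [hν' b x hx.1, hν' b' x hx.2]
  have h2 : ∀ b b', ∀ x ∈ U b ∩ U b',
      P.proj (P.ract (κ b x) (torsorDiv N.lact (ν b x) (ν b' x))) = P.proj (κ b' x) :=
    fun b b' x hx => by rw [P.proj_ract, hκ' b x hx.1, hκ' b' x hx.2, h1 b b' x hx]
  let Z : PrincipalBundleCore (VB := VY) (VD := VD) π act :=
    { one_act := fun p => Subtype.ext (Prod.ext rfl (P.isPrincipal.one_act p.1.2))
      mul_act := fun g g' p => Subtype.ext (Prod.ext rfl (P.isPrincipal.mul_act g g' p.1.2))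
      proj_act := fun g p => rfl
      act_injective := fun p g g' h =>
        P.isPrincipal.act_injective p.1.2 (congrArg (fun p : T => p.1.2) h)
      exists_act_eq := fun p q h => by
        obtain ⟨g, hg⟩ := P.isPrincipal.exists_act_eq (p := p.1.2) (q := q.1.2) (by
          rw [p.2, q.2]
          exact congrArg ℘ h)
        exact ⟨g, Subtype.ext (Prod.ext h.symm hg)⟩
      U := U
      isOpen_U := hU
      mem_U := hbU
      s := fun b x => ε (κ b x) (ν b x)
      proj_s := fun b x hx => (π_ε (hκ' b x hx)).trans (hν' b x hx)
      -- If ν_b = k ν_b', then [κ_b, ν_b] = [κ_b ◁ k, ν_b'], so the transition function is the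
      -- quotient of κ_b ◁ k by κ_b'.
      exists_transition := fun b b' => by
        refine ⟨fun x => torsorDiv P.act (P.ract (κ b x) (torsorDiv N.lact (ν b x) (ν b' x)))
          (κ b' x), fun x hx => ?_, fun x hx => ?_⟩
        · exact P.isPrincipal.contMDiffWithinAt_torsorDiv
            (P.contMDiffWithinAt_ract ((hκ b).mono Set.inter_subset_left x hx)
              (N.isLeft.contMDiffWithinAt_torsorDiv ((hν b).mono Set.inter_subset_left x hx)
                ((hν b').mono Set.inter_subset_right x hx) hx (h1 b b')))
            ((hκ b').mono Set.inter_subset_right x hx) hx (h2 b b')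
        · rw [← ε_act (hκ' b' x hx.2), P.isPrincipal.torsorDiv_act_eq (h2 b b' x hx),
            ε_ract ((hκ' b x hx.1).trans (congrArg ℘ (h1 b b' x hx))),
            N.isLeft.torsorDiv_act_eq (h1 b b' x hx)] }
  let Q : DHBundle Ξ VY Y := Z.toDHBundle Ξ ψ
    (fun d p => by
      show P.ψ (P.act d p.1.2) * N.phiAut (n₀ p.1.1) = _
      rw [P.ψ_act, mul_assoc])
    (fun b y hy => by
      have h : ContMDiffWithinAt (𝓘(ℝ, VY).prod 𝓘(ℝ, VH)) 𝓘(ℝ, VH) ∞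
          (fun y : Y × H => P.ψ (κ b y.1) (N.phi (ν b y.1) y.2)) (U b ×ˢ Set.univ) y :=
        P.contMDiffWithinAt_ψ ((hκ b).comp contMDiffOn_fst (fun w hw => hw.1) y hy)
          (N.contMDiffWithinAt_phi ((hν b).comp contMDiffOn_fst (fun w hw => hw.1) y hy)
            contMDiffWithinAt_snd hy)
      exact h.congr_of_mem (fun w hw => DFunLike.congr_fun (ψ_ε (hκ' b w.1 hw.1)) w.2) hy)
    (fun b y hy => by
      have h : ContMDiffWithinAt (𝓘(ℝ, VY).prod 𝓘(ℝ, VH)) 𝓘(ℝ, VH) ∞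
          (fun y : Y × H => N.inv.phi (ν b y.1) ((P.ψ (κ b y.1)).symm y.2))
          (U b ×ˢ Set.univ) y :=
        N.inv.contMDiffWithinAt_phi ((hν b).comp contMDiffOn_fst (fun w hw => hw.1) y hy)
          (P.contMDiffWithinAt_ψ_symm ((hκ b).comp contMDiffOn_fst (fun w hw => hw.1) y hy)
            contMDiffWithinAt_snd) hy
      exact h.congr_of_mem (fun w hw => congrArg (fun e : MulAut H => e.symm w.2)
        (ψ_ε (hκ' b w.1 hw.1))) hy)
  refine ⟨Q, ε, ?_, fun p n h => π_ε h, fun p n k h => ε_ract h k, fun d p n h => ε_act h d,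
    fun p n k h => DFunLike.congr_fun (ψ_ε h) k⟩
  rintro ⟨p, n⟩ (h : P.proj p = ℘ (N.proj n))
  let b := N.proj n
  let R : Set (P.carrier × N.carrier) := {w | P.proj w.1 = ℘ (N.proj w.2)}
  let f : P.carrier × N.carrier → Y := fun w => N.proj w.2
  have hf : ContMDiff ((𝓘(ℝ, VM).prod 𝓘(ℝ, VD)).prod 𝓘(ℝ, VN)) 𝓘(ℝ, VY) ∞ f :=
    N.isLeft.smooth_proj.comp contMDiff_snd
  have hO : IsOpen (f ⁻¹' U b) := (hU b).preimage hf.continuous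
  have hx : (p, n) ∈ R ∩ f ⁻¹' U b := ⟨h, hbU b⟩
  have hmaps : Set.MapsTo f (R ∩ f ⁻¹' U b) (U b) := fun w hw => hw.2
  have h3 : ∀ w ∈ R ∩ f ⁻¹' U b, N.proj w.2 = N.proj (ν b (f w)) :=
    fun w hw => (hν' b (f w) hw.2).symm
  have h4 : ∀ w ∈ R ∩ f ⁻¹' U b,
      P.proj (P.ract w.1 (torsorDiv N.lact w.2 (ν b (f w)))) = P.proj (κ b (f w)) :=
    fun w hw => by rw [P.proj_ract, hκ' b _ hw.2, ← h3 w hw]; exact hw.1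
  have hκp := (hκ b).comp hf.contMDiffOn hmaps (p, n) hx
  have hνp := (hν b).comp hf.contMDiffOn hmaps (p, n) hx
  have hs := Z.contMDiffOn_localSection b |>.comp hf.contMDiffOn hmaps (p, n) hx
  have key := Z.isPrincipalBundle.contMDiffWithinAt_act
    (P.isPrincipal.contMDiffWithinAt_torsorDiv
      (P.contMDiffWithinAt_ract contMDiffWithinAt_fst
        (N.isLeft.contMDiffWithinAt_torsorDiv contMDiffWithinAt_snd hνp hx h3)) hκp hx h4) hs
  refine (key.congr_of_mem (fun w hw => ?_) hx).mono_of_mem_nhdsWithin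
    (Filter.inter_mem self_mem_nhdsWithin (mem_nhdsWithin_of_mem_nhds (hO.mem_nhds hx.2)))
  have h5 := ε_act (hκ' b _ hw.2)
    (torsorDiv P.act (P.ract w.1 (torsorDiv N.lact w.2 (ν b (f w)))) (κ b (f w)))
  rw [P.isPrincipal.torsorDiv_act_eq (h4 w hw),
    ε_ract (hw.1.trans (congrArg ℘ (h3 w hw))), N.isLeft.torsorDiv_act_eq (h3 w hw)] at h5
  exact h5

variable {𝒢 : BundleGerbe VY ℘ VH H VE}

/-- For every `D`-`H` bundle `P` over `M`, the bundle `℘^*(P) 𝓝` is a module. -/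
theorem DHBundle.exists_isTwist (P : DHBundle Ξ VM M) (𝒯 : 𝒢.Trivialization VN)
    (h℘ : ContMDiff 𝓘(ℝ, VY) 𝓘(ℝ, VM) ∞ ℘) :
    ∃ (K : GerbeModule Ξ 𝒢) (ε : P.carrier → 𝒯.N.carrier → K.Q.carrier), IsTwist 𝒯 P K ε := by
  obtain ⟨Q, ε, hε⟩ := P.exists_isDHProduct_pullback 𝒯.N h℘
  -- Every pair (q, e) of the fibre product is ([p, n], β(n, n')) for some triple (p, n, n').
  have hex : ∀ {q e}, Q.proj q = (𝒢.E.proj e).1 → ∃ p n n', P.proj p = ℘ (𝒯.N.proj n) ∧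
      ℘ (𝒯.N.proj n) = ℘ (𝒯.N.proj n') ∧ ε p n = q ∧ 𝒯.β n n' = e := fun {q e} h => by
    obtain ⟨n, hn⟩ := 𝒯.N.isLeft.exists_proj_eq (Set.mem_univ (Q.proj q))
    obtain ⟨p, hp, hpq⟩ := hε.exists_eq (b := ℘ (𝒯.N.proj n)) (a := n) (p := q) rfl hn.symm
    obtain ⟨n', -, h', hn'⟩ := 𝒯.exists_β_eq (n := n) (e := e) (by rw [hn, h])
    exact ⟨p, n, n', hp, h', hpq, hn'⟩
  -- Two such triples differ by some k in H: n₁ = k n₂, p₂ = p₁ ◁ k and n₂' = k⁻¹ n₁'. Hence [p, n']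
  -- depends only on (q, e).
  have huniq : ∀ {p₁ p₂ n₁ n₁' n₂ n₂'}, P.proj p₁ = ℘ (𝒯.N.proj n₁) →
      ℘ (𝒯.N.proj n₁) = ℘ (𝒯.N.proj n₁') → P.proj p₂ = ℘ (𝒯.N.proj n₂) →
      ℘ (𝒯.N.proj n₂) = ℘ (𝒯.N.proj n₂') → ε p₁ n₁ = ε p₂ n₂ → 𝒯.β n₁ n₁' = 𝒯.β n₂ n₂' →
      ε p₁ n₁' = ε p₂ n₂' := by
    intro p₁ p₂ n₁ n₁' n₂ n₂' hp₁ h₁ hp₂ h₂ hε' hβ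
    have hn : 𝒯.N.proj n₁ = 𝒯.N.proj n₂ := by
      rw [← hε.proj_eq _ _ hp₁, hε', hε.proj_eq _ _ hp₂]
    obtain ⟨k, rfl⟩ := 𝒯.N.isLeft.exists_act_eq hn
    rw [𝒯.N.proj_lact] at hp₁ h₁
    rw [← hε.balanced _ _ _ hp₁] at hε'
    have hp : P.ract p₁ k = p₂ := hε.injective hp₂ (by rw [P.proj_ract, hp₁, hp₂]) hε'
    rw [𝒯.β_lact_left h₁] at hβ
    obtain rfl : 𝒯.N.lact k⁻¹ n₁' = n₂' :=
      𝒯.β_injective (by rw [𝒯.N.proj_lact, h₁]) h₂ hβ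
    rw [← hp, hε.balanced _ _ _ (by rw [𝒯.N.proj_lact, hp₁, h₁]), 𝒯.N.isLeft.act_inv_act]
  classical
  let z : Q.carrier → 𝒢.E.carrier → Q.carrier := fun q e =>
    if h : Q.proj q = (𝒢.E.proj e).1 then ε (hex h).choose (hex h).choose_spec.choose_spec.choose
    else q
  have hz : ∀ {p n n'}, P.proj p = ℘ (𝒯.N.proj n) → ℘ (𝒯.N.proj n) = ℘ (𝒯.N.proj n') →
      z (ε p n) (𝒯.β n n') = ε p n' := fun {p n n'} hp hn => by
    have h : Q.proj (ε p n) = (𝒢.E.proj (𝒯.β n n')).1 := by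
      rw [hε.proj_eq _ _ hp, 𝒯.proj_β hn]
    obtain ⟨h₁, h₂, h₃, h₄⟩ := (hex h).choose_spec.choose_spec.choose_spec
    simp only [z, dif_pos h]
    exact huniq h₁ h₂ hp hn h₃ h₄
  have hzprod : IsDHProduct (fun y w => y = w.1) (fun _ w => w.2) Q 𝒢.E Q z := by
    refine ⟨?_, fun q e h => ?_, fun q e k h => ?_, fun d q e h => ?_, fun q e k h => ?_⟩
    · rintro ⟨q, e⟩ (h : Q.proj q = (𝒢.E.proj e).1)
      -- With smooth sections κ, ν, ν₁, write q = d [κ, ν] and e = β(ν, ν₁) ◁ g⁻¹ with quotients d,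
      -- g depending smoothly on (q, e). Then z(q, e) = d [κ, ν₁ ◁ g⁻¹]. The inverse appears because
      -- the right action is treated as the left action e ↦ e ◁ h⁻¹.
      obtain ⟨V, hV, hb, ν, hν, hν'⟩ := 𝒯.N.isLeft.exists_section (Q.proj q)
      obtain ⟨V₁, hV₁, hb₁, ν₁, hν₁, hν₁'⟩ := 𝒯.N.isLeft.exists_section (𝒢.E.proj e).2
      obtain ⟨V₂, hV₂, hb₂, κ, hκ, hκ'⟩ := P.isPrincipal.exists_section (℘ (Q.proj q))
      let y : Q.carrier × 𝒢.E.carrier → Y := fun w => Q.proj w.1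
      let y₁ : Q.carrier × 𝒢.E.carrier → Y := fun w => (𝒢.E.proj w.2).2
      have hy : ContMDiff ((𝓘(ℝ, VY).prod 𝓘(ℝ, VD)).prod 𝓘(ℝ, VE)) 𝓘(ℝ, VY) ∞ y :=
        Q.isPrincipal.smooth_proj.comp contMDiff_fst
      have hy₁ : ContMDiff ((𝓘(ℝ, VY).prod 𝓘(ℝ, VD)).prod 𝓘(ℝ, VE)) 𝓘(ℝ, VY) ∞ y₁ :=
        contMDiff_snd.comp (𝒢.E.isLeft.smooth_proj.comp contMDiff_snd)
      let O := y ⁻¹' V ∩ y₁ ⁻¹' V₁ ∩ (fun w => ℘ (y w)) ⁻¹' V₂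
      have hO : IsOpen O := ((hV.preimage hy.continuous).inter (hV₁.preimage hy₁.continuous)).inter
        (hV₂.preimage (h℘.comp hy).continuous)
      let R : Set (Q.carrier × 𝒢.E.carrier) := {w | Q.proj w.1 = (𝒢.E.proj w.2).1}
      have hx : (q, e) ∈ R ∩ O := ⟨h, ⟨hb, hb₁⟩, hb₂⟩
      have hνy := hν.comp hy.contMDiffOn (s := R ∩ O) (fun w hw => hw.2.1.1) (q, e) hx
      have hνy₁ := hν₁.comp hy₁.contMDiffOn (s := R ∩ O) (fun w hw => hw.2.1.2) (q, e) hx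
      have hκy := hκ.comp (h℘.comp hy).contMDiffOn (s := R ∩ O) (fun w hw => hw.2.2) (q, e) hx
      have e1 : ∀ w ∈ R ∩ O, P.proj (κ (℘ (y w))) = ℘ (𝒯.N.proj (ν (y w))) := fun w hw => by
        rw [hκ' _ hw.2.2, hν' _ hw.2.1.1]
      have e2 : ∀ w ∈ R ∩ O, ℘ (𝒯.N.proj (ν (y w))) = ℘ (𝒯.N.proj (ν₁ (y₁ w))) :=
        fun w hw => by
        rw [hν' _ hw.2.1.1, hν₁' _ hw.2.1.2]
        exact (congrArg ℘ hw.1).trans (𝒢.E.isLeft.proj_mem w.2)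
      have e3 : ∀ w ∈ R ∩ O, Q.proj w.1 = Q.proj (ε (κ (℘ (y w))) (ν (y w))) := fun w hw => by
        rw [hε.proj_eq _ _ (e1 w hw), hν' _ hw.2.1.1]
      have e4 : ∀ w ∈ R ∩ O, 𝒢.E.proj w.2 = 𝒢.E.proj (𝒯.β (ν (y w)) (ν₁ (y₁ w))) :=
        fun w hw => by
        rw [𝒯.proj_β (e2 w hw), hν' _ hw.2.1.1, hν₁' _ hw.2.1.2]
        exact Prod.ext hw.1.symm rfl
      let d : Q.carrier × 𝒢.E.carrier → D := fun w =>
        torsorDiv Q.act w.1 (ε (κ (℘ (y w))) (ν (y w)))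
      let g : Q.carrier × 𝒢.E.carrier → H := fun w =>
        torsorDiv (fun h e => 𝒢.E.ract e h⁻¹) w.2 (𝒯.β (ν (y w)) (ν₁ (y₁ w)))
      have hd : ContMDiffWithinAt ((𝓘(ℝ, VY).prod 𝓘(ℝ, VD)).prod 𝓘(ℝ, VE)) 𝓘(ℝ, VD) ∞ d
          (R ∩ O) (q, e) := Q.isPrincipal.contMDiffWithinAt_torsorDiv contMDiffWithinAt_fst
        (hε.contMDiffWithinAt hκy hνy hx e1) hx e3
      have hg : ContMDiffWithinAt ((𝓘(ℝ, VY).prod 𝓘(ℝ, VD)).prod 𝓘(ℝ, VE)) 𝓘(ℝ, VH) ∞ g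
          (R ∩ O) (q, e) := 𝒢.E.isRight.contMDiffWithinAt_torsorDiv contMDiffWithinAt_snd
        (𝒯.contMDiffWithinAt_β hνy hνy₁ hx e2) hx e4
      have e5 : ∀ w ∈ R ∩ O,
          P.proj (κ (℘ (y w))) = ℘ (𝒯.N.proj (𝒯.N.ract (ν₁ (y₁ w)) (g w)⁻¹)) := fun w hw => by
        rw [𝒯.N.proj_ract, e1 w hw, e2 w hw]
      have key := Q.isPrincipal.contMDiffWithinAt_act hd (hε.contMDiffWithinAt hκy
        (𝒯.N.contMDiffWithinAt_ract hνy₁ hg.inv) hx e5)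
      refine (key.congr_of_mem (fun w hw => ?_) hx).mono_of_mem_nhdsWithin
        (Filter.inter_mem self_mem_nhdsWithin (mem_nhdsWithin_of_mem_nhds (hO.mem_nhds hx.2)))
      have e6 : P.proj (P.act (d w) (κ (℘ (y w)))) = ℘ (𝒯.N.proj (ν (y w))) := by
        rw [P.proj_act, e1 w hw]
      have e7 : 𝒢.E.ract (𝒯.β (ν (y w)) (ν₁ (y₁ w))) (g w)⁻¹ = w.2 :=
        𝒢.E.isRight.torsorDiv_act_eq (e4 w hw)
      have e8 : Q.act (d w) (ε (κ (℘ (y w))) (ν (y w))) = w.1 :=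
        Q.isPrincipal.torsorDiv_act_eq (e3 w hw)
      have e9 := hz e6 (n' := 𝒯.N.ract (ν₁ (y₁ w)) (g w)⁻¹)
        (by rw [𝒯.N.proj_ract, e2 w hw])
      rw [𝒯.β_ract (e2 w hw), e7, hε.map_act _ _ _ (e1 w hw), e8,
        hε.map_act _ _ _ (e5 w hw)] at e9
      exact e9
    · obtain ⟨p, n, n', hp, hn, rfl, rfl⟩ := hex h
      rw [hz hp hn, hε.proj_eq _ _ (hp.trans hn), 𝒯.proj_β hn]
    -- From q ◁ k = [p, n] one gets q = [p, n ◁ k⁻¹], and β(n ◁ k⁻¹, n') = k e.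
    · obtain ⟨p, n, n', hp, hn, hq, he⟩ := hex ((Q.proj_ract q k).trans h)
      have hn' : ℘ (𝒯.N.proj (𝒯.N.ract n k⁻¹)) = ℘ (𝒯.N.proj n') := by rw [𝒯.N.proj_ract, hn]
      have hp' : P.proj p = ℘ (𝒯.N.proj (𝒯.N.ract n k⁻¹)) := by rw [𝒯.N.proj_ract, hp]
      have hq' : ε p (𝒯.N.ract n k⁻¹) = q := by
        rw [hε.ract_eq hp, hq, ← Q.ract_mul, mul_inv_cancel, Q.ract_one]
      have := hz hp' hn'
      rw [hq', 𝒯.β_ract_left hn, inv_inv, he] at this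
      rw [this, ← hq, ← he, hz hp hn]
    · obtain ⟨p, n, n', hp, hn, rfl, rfl⟩ := hex h
      rw [← hε.map_act _ _ _ hp, hz ((P.proj_act d p).trans hp) hn, hz hp hn,
        hε.map_act _ _ _ (hp.trans hn)]
    · obtain ⟨p, n, n', hp, hn, rfl, rfl⟩ := hex h
      rw [hz hp hn, hε.ψ_eq _ _ _ (hp.trans hn), hε.ψ_eq _ _ _ hp, 𝒯.phi_β hn,
        𝒯.N.phi_phi_inv]
  refine ⟨⟨Q, z, hzprod, fun q e e' h h' => ?_⟩, ε, hε, fun p n n' hp hn => hz hp hn⟩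
  obtain ⟨p, n, n', hp, hn, rfl, rfl⟩ := hex h
  rw [𝒯.proj_β hn] at h'
  obtain ⟨n'', -, hn'', rfl⟩ := 𝒯.exists_β_eq (n := n') h'.symm
  rw [hz hp hn, hz (hp.trans hn) hn'', 𝒯.f_β _ _ _ hn hn'', hz hp (hn.trans hn'')]

end Twist

/-! ### Morphisms of D-H bundles are isomorphisms -/

section DHMorphisms

variable {VB : Type*} [NormedAddCommGroup VB] [NormedSpace ℝ VB]
  {VH : Type*} [NormedAddCommGroup VH] [NormedSpace ℝ VH]
  {VD : Type*} [NormedAddCommGroup VD] [NormedSpace ℝ VD]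
  {B : Type u} [TopologicalSpace B] [ChartedSpace VB B]
  {H : Type u} [Group H] [TopologicalSpace H] [ChartedSpace VH H]
  {D : Type u} [Group D] [TopologicalSpace D] [ChartedSpace VD D]
  {Ξ : LieCrossedModule VH VD H D}

namespace DHBundle

theorem hom_ext {Q Q' : DHBundle Ξ VB B} {f g : Q ⟶ Q'} (h : ∀ q, f.toFun q = g.toFun q) :
    f = g :=
  Hom.ext (funext h)

variable [LieGroup 𝓘(ℝ, VD) ∞ D]

/-- An equivariant map is smooth if it is so along local sections. -/
theorem contMDiff_of_section {Q Q' : DHBundle Ξ VB B} {f : Q.carrier → Q'.carrier}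
    (map_act : ∀ d q, f (Q.act d q) = Q'.act d (f q))
    (h : ∀ b, ∃ U : Set B, IsOpen U ∧ b ∈ U ∧ ∃ s : B → Q.carrier,
      ContMDiffOn 𝓘(ℝ, VB) (𝓘(ℝ, VB).prod 𝓘(ℝ, VD)) ∞ s U ∧ (∀ x ∈ U, Q.proj (s x) = x) ∧
      ContMDiffOn 𝓘(ℝ, VB) (𝓘(ℝ, VB).prod 𝓘(ℝ, VD)) ∞ (fun x => f (s x)) U) :
    ContMDiff (𝓘(ℝ, VB).prod 𝓘(ℝ, VD)) (𝓘(ℝ, VB).prod 𝓘(ℝ, VD)) ∞ f := by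
  intro q
  obtain ⟨U, hU, hb, s, hs, hs', hf⟩ := h (Q.proj q)
  refine contMDiffAt_of_section hU hb hs hs' (F := fun d x => Q'.act d (f (s x))) ?_
    fun d x _ => map_act d _
  intro y hy
  exact Q'.isPrincipal.contMDiffWithinAt_act contMDiffWithinAt_fst
    (hf.comp contMDiffOn_snd (fun w hw => hw.2) y hy)

/-- Every morphism of `D`-`H` bundles is an isomorphism. -/
theorem isIso {Q Q' : DHBundle Ξ VB B} (f : Q ⟶ Q') : IsIso f := by
  have hinj : Function.Injective f.toFun := fun q q' h => by
    have hp : Q.proj q = Q.proj q' := by rw [← f.proj_eq, h, f.proj_eq]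
    obtain ⟨d, rfl⟩ := Q.isPrincipal.exists_act_eq hp
    have hd : d = 1 := Q'.isPrincipal.act_injective (f.toFun q') (by
      show Q'.act d _ = Q'.act 1 _
      rw [← f.map_act, h, Q'.isPrincipal.one_act])
    rw [hd, Q.isPrincipal.one_act]
  have hsurj : ∀ q', ∃ q, f.toFun q = q' := fun q' => by
    obtain ⟨q, hq⟩ := Q.isPrincipal.exists_proj_eq (Set.mem_univ (Q'.proj q'))
    obtain ⟨d, hd⟩ := Q'.isPrincipal.exists_act_eq (p := q') (q := f.toFun q)
      (by rw [f.proj_eq, hq])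
    exact ⟨Q.act d q, by rw [f.map_act, hd]⟩
  choose g hg using hsurj
  have hgf : ∀ q, g (f.toFun q) = q := fun q => hinj (hg _)
  have g_act : ∀ d q, g (Q'.act d q) = Q.act d (g q) := fun d q =>
    hinj (by rw [hg, f.map_act, hg])
  -- Along the section f ∘ s of the target, the inverse map is the smooth section s.
  have g_smooth := contMDiff_of_section g_act fun b => by
    obtain ⟨U, hU, hb, s, hs, hs'⟩ := Q.isPrincipal.exists_section b
    refine ⟨U, hU, hb, fun x => f.toFun (s x), f.smooth.comp_contMDiffOn hs,
      fun x hx => (f.proj_eq _).trans (hs' x hx), ?_⟩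
    simpa only [hgf] using hs
  let v : Q' ⟶ Q := ⟨g, g_smooth, fun q => by rw [← f.proj_eq, hg], g_act,
    fun q => by rw [← f.ψ_eq, hg]⟩
  exact ⟨v, hom_ext hgf, hom_ext hg⟩

end DHBundle

end DHMorphisms

/-! ### Induced morphisms, and comparison of the two constructions -/

section ModuleMorphisms

variable {VM : Type*} [NormedAddCommGroup VM] [NormedSpace ℝ VM]
  {VY : Type*} [NormedAddCommGroup VY] [NormedSpace ℝ VY]
  {VH : Type*} [NormedAddCommGroup VH] [NormedSpace ℝ VH]
  {VD : Type*} [NormedAddCommGroup VD] [NormedSpace ℝ VD]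
  {VE : Type*} [NormedAddCommGroup VE] [NormedSpace ℝ VE]
  {VN : Type*} [NormedAddCommGroup VN] [NormedSpace ℝ VN]
  {M : Type u}
  {Y : Type u} [TopologicalSpace Y] [ChartedSpace VY Y]
  {H : Type u} [Group H] [TopologicalSpace H] [ChartedSpace VH H]
  {D : Type u} [Group D] [TopologicalSpace D] [ChartedSpace VD D]
  {Ξ : LieCrossedModule VH VD H D} {℘ : Y → M} {𝒢 : BundleGerbe VY ℘ VH H VE}
  {𝒯 : 𝒢.Trivialization VN}

theorem GerbeModule.hom_ext {K K' : GerbeModule Ξ 𝒢} {u v : K ⟶ K'}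
    (h : ∀ q, u.hom.toFun q = v.hom.toFun q) : u = v :=
  Hom.ext (DHBundle.hom_ext h)

namespace IsDescent

variable [TopologicalSpace M] [ChartedSpace VM M] {K K' : GerbeModule Ξ 𝒢} {P P' : DHBundle Ξ VM M}
  {δ : K.Q.carrier → 𝒯.N.carrier → P.carrier} {δ' : K'.Q.carrier → 𝒯.N.carrier → P'.carrier}

theorem proj_eq (hδ : IsDescent 𝒯 K P δ) {q : K.Q.carrier} {n : 𝒯.N.carrier}
    (h : K.Q.proj q = 𝒯.N.proj n) : P.proj (δ q n) = ℘ (𝒯.N.proj n) :=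
  (hδ.isProduct.proj_eq q n h).trans (congrArg ℘ h)

theorem map_act (hδ : IsDescent 𝒯 K P δ) {q : K.Q.carrier} {n : 𝒯.N.carrier}
    (h : K.Q.proj q = 𝒯.N.proj n) (d : D) : δ (K.Q.act d q) n = P.act d (δ q n) :=
  hδ.isProduct.map_act d q n h

theorem ψ_eq (hδ : IsDescent 𝒯 K P δ) {q : K.Q.carrier} {n : 𝒯.N.carrier}
    (h : K.Q.proj q = 𝒯.N.proj n) : P.ψ (δ q n) = K.Q.ψ q * (𝒯.N.phiAut n)⁻¹ := by
  ext k
  exact hδ.isProduct.ψ_eq q n k h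

theorem exists_eq (hδ : IsDescent 𝒯 K P δ) (h_surj : Function.Surjective ℘) (p : P.carrier) :
    ∃ q n, K.Q.proj q = 𝒯.N.proj n ∧ δ q n = p := by
  obtain ⟨y, hy⟩ := h_surj (P.proj p)
  obtain ⟨n, rfl⟩ := 𝒯.N.isLeft.exists_proj_eq (Set.mem_univ y)
  obtain ⟨q, hq, h⟩ := hδ.isProduct.exists_eq (b := 𝒯.N.proj n) (a := n) (p := p) rfl hy.symm
  exact ⟨q, n, hq, h⟩

/-- Equality of points of a descended bundle. -/
theorem z_eq_of_eq (hδ : IsDescent 𝒯 K P δ) {q q' : K.Q.carrier} {n n' : 𝒯.N.carrier}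
    (h : K.Q.proj q = 𝒯.N.proj n) (h' : K.Q.proj q' = 𝒯.N.proj n') (e : δ q n = δ q' n') :
    ℘ (𝒯.N.proj n) = ℘ (𝒯.N.proj n') ∧ K.z q (𝒯.β n n') = q' := by
  have hn : ℘ (𝒯.N.proj n) = ℘ (𝒯.N.proj n') := by
    rw [← hδ.proj_eq h, e, hδ.proj_eq h']
  refine ⟨hn, hδ.isProduct.injective (a := n') h' ?_ ?_⟩
  · rw [K.proj_z_β h hn, h']
  · rw [hδ.descent _ _ _ h hn, e]

/-- The values of δ on the fibre product exhaust P; the functor laws are checked on them. -/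
theorem hom_ext (hδ : IsDescent 𝒯 K P δ) (h_surj : Function.Surjective ℘) {v w : P ⟶ P'}
    (h : ∀ q n, K.Q.proj q = 𝒯.N.proj n → v.toFun (δ q n) = w.toFun (δ q n)) : v = w :=
  DHBundle.hom_ext fun p => by
    obtain ⟨q, n, hq, rfl⟩ := hδ.exists_eq h_surj p
    exact h q n hq

/-- A morphism of modules induces a morphism of the descended bundles. -/
theorem exists_map [LieGroup 𝓘(ℝ, VD) ∞ D] (hδ : IsDescent 𝒯 K P δ) (hδ' : IsDescent 𝒯 K' P' δ')
    (h_surj : Function.Surjective ℘) (h_subm : Manifold.IsSubmersion 𝓘(ℝ, VY) 𝓘(ℝ, VM) ∞ ℘)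
    (u : K ⟶ K') :
    ∃ v : P ⟶ P', ∀ q n, K.Q.proj q = 𝒯.N.proj n →
      v.toFun (δ q n) = δ' (u.hom.toFun q) n := by
  -- Two representatives of p differ by a transport along β, with which `u` commutes, and δ' does
  -- not see the transport.
  have hex : ∀ p, ∃ p', ∀ q n, K.Q.proj q = 𝒯.N.proj n → δ q n = p →
      δ' (u.hom.toFun q) n = p' := fun p => by
    obtain ⟨q', n', hq', rfl⟩ := hδ.exists_eq h_surj p
    refine ⟨δ' (u.hom.toFun q') n', fun q n hq h => ?_⟩
    obtain ⟨hn, rfl⟩ := hδ.z_eq_of_eq hq hq' h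
    rw [u.z_eq _ _ (K.proj_eq_proj_β hq hn),
      hδ'.descent _ _ _ ((u.hom.proj_eq q).trans hq) hn]
  choose f hf using hex
  have hf' : ∀ {q n}, K.Q.proj q = 𝒯.N.proj n → f (δ q n) = δ' (u.hom.toFun q) n :=
    fun h => (hf _ _ _ h rfl).symm
  have hu : ∀ {q n}, K.Q.proj q = 𝒯.N.proj n → K'.Q.proj (u.hom.toFun q) = 𝒯.N.proj n :=
    fun h => (u.hom.proj_eq _).trans h
  have f_act : ∀ d p, f (P.act d p) = P'.act d (f p) := fun d p => by
    obtain ⟨q, n, hq, rfl⟩ := hδ.exists_eq h_surj p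
    rw [← hδ.map_act hq, hf' ((K.Q.proj_act d q).trans hq), hf' hq, u.hom.map_act,
      hδ'.map_act (hu hq)]
  refine ⟨⟨f, DHBundle.contMDiff_of_section f_act fun b => ?_, fun p => ?_, f_act, fun p => ?_⟩,
    fun q n h => hf' h⟩
  · obtain ⟨U, hU, hb, n, q, hn, hq, hn', hq'⟩ := 𝒯.exists_section h_surj h_subm K.Q b
    refine ⟨U, hU, hb, fun x => δ (q x) (n x), fun x hx => ?_, fun x hx => ?_, ?_⟩
    · exact hδ.isProduct.contMDiffWithinAt (a := n) (hq x hx) (hn x hx) hx hq'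
    · rw [hδ.proj_eq (hq' x hx), hn' x hx]
    · have h : ContMDiffOn 𝓘(ℝ, VM) (𝓘(ℝ, VM).prod 𝓘(ℝ, VD)) ∞
          (fun x => δ' (u.hom.toFun (q x)) (n x)) U := fun x hx =>
        hδ'.isProduct.contMDiffWithinAt (a := n) (u.hom.smooth.comp_contMDiffOn hq x hx) (hn x hx)
          hx fun w hw => hu (hq' w hw)
      exact h.congr fun x hx => hf' (hq' x hx)
  · obtain ⟨q, n, hq, rfl⟩ := hδ.exists_eq h_surj p
    rw [hf' hq, hδ.proj_eq hq, hδ'.proj_eq (hu hq)]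
  · obtain ⟨q, n, hq, rfl⟩ := hδ.exists_eq h_surj p
    rw [hf' hq, hδ.ψ_eq hq, hδ'.ψ_eq (hu hq), u.hom.ψ_eq]

end IsDescent

namespace IsTwist

variable [TopologicalSpace M] [ChartedSpace VM M] {K K' : GerbeModule Ξ 𝒢} {P P' : DHBundle Ξ VM M}
  {ε : P.carrier → 𝒯.N.carrier → K.Q.carrier} {ε' : P'.carrier → 𝒯.N.carrier → K'.Q.carrier}

theorem proj_eq (hε : IsTwist 𝒯 P K ε) {p : P.carrier} {n : 𝒯.N.carrier}
    (h : P.proj p = ℘ (𝒯.N.proj n)) : K.Q.proj (ε p n) = 𝒯.N.proj n :=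
  hε.isProduct.proj_eq p n h

theorem map_act (hε : IsTwist 𝒯 P K ε) {p : P.carrier} {n : 𝒯.N.carrier}
    (h : P.proj p = ℘ (𝒯.N.proj n)) (d : D) : ε (P.act d p) n = K.Q.act d (ε p n) :=
  hε.isProduct.map_act d p n h

theorem ψ_eq (hε : IsTwist 𝒯 P K ε) {p : P.carrier} {n : 𝒯.N.carrier}
    (h : P.proj p = ℘ (𝒯.N.proj n)) : K.Q.ψ (ε p n) = P.ψ p * 𝒯.N.phiAut n := by
  ext k
  exact hε.isProduct.ψ_eq p n k h

theorem exists_eq (hε : IsTwist 𝒯 P K ε) (q : K.Q.carrier) :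
    ∃ p n, P.proj p = ℘ (𝒯.N.proj n) ∧ ε p n = q := by
  obtain ⟨n, hn⟩ := 𝒯.N.isLeft.exists_proj_eq (Set.mem_univ (K.Q.proj q))
  obtain ⟨p, hp, h⟩ := hε.isProduct.exists_eq (b := ℘ (𝒯.N.proj n)) (a := n) (p := q) rfl hn.symm
  exact ⟨p, n, hp, h⟩

/-- Equality of points of a twisted pull-back. -/
theorem exists_lact_eq_of_eq (hε : IsTwist 𝒯 P K ε) {p p' : P.carrier} {n n' : 𝒯.N.carrier}
    (h : P.proj p = ℘ (𝒯.N.proj n)) (h' : P.proj p' = ℘ (𝒯.N.proj n')) (e : ε p n = ε p' n') :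
    ∃ k, 𝒯.N.lact k n' = n ∧ P.ract p k = p' := by
  have hn : 𝒯.N.proj n = 𝒯.N.proj n' := by
    rw [← hε.proj_eq h, e, hε.proj_eq h']
  obtain ⟨k, rfl⟩ := 𝒯.N.isLeft.exists_act_eq hn
  rw [hn] at h
  refine ⟨k, rfl, hε.isProduct.injective (a := n') h' ?_ ?_⟩
  · rw [P.proj_ract, h, h']
  · rw [hε.isProduct.balanced _ _ _ h, e]

theorem hom_ext (hε : IsTwist 𝒯 P K ε) {v w : K ⟶ K'}
    (h : ∀ p n, P.proj p = ℘ (𝒯.N.proj n) →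
      v.hom.toFun (ε p n) = w.hom.toFun (ε p n)) : v = w :=
  GerbeModule.hom_ext fun q => by
    obtain ⟨p, n, hp, rfl⟩ := hε.exists_eq q
    exact h p n hp

variable [LieGroup 𝓘(ℝ, VD) ∞ D]

/-- A morphism of `D`-`H` bundles induces a morphism of the twisted pull-backs. -/
theorem exists_map (hε : IsTwist 𝒯 P K ε) (hε' : IsTwist 𝒯 P' K' ε')
    (h℘ : ContMDiff 𝓘(ℝ, VY) 𝓘(ℝ, VM) ∞ ℘) (v : P ⟶ P') :
    ∃ u : K ⟶ K', ∀ p n, P.proj p = ℘ (𝒯.N.proj n) →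
      u.hom.toFun (ε p n) = ε' (v.toFun p) n := by
  have hv : ∀ {p n}, P.proj p = ℘ (𝒯.N.proj n) → P'.proj (v.toFun p) = ℘ (𝒯.N.proj n) :=
    fun h => (v.proj_eq _).trans h
  -- Two representatives of q differ by an element of H moved across; `v` commutes with the right
  -- action because it respects the action of D and ψ.
  have hex : ∀ q, ∃ q', ∀ p n, P.proj p = ℘ (𝒯.N.proj n) → ε p n = q →
      ε' (v.toFun p) n = q' := fun q => by
    obtain ⟨p', n', hp', rfl⟩ := hε.exists_eq q
    refine ⟨ε' (v.toFun p') n', fun p n hp h => ?_⟩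
    obtain ⟨k, rfl, rfl⟩ := hε.exists_lact_eq_of_eq hp hp' h
    rw [𝒯.N.proj_lact] at hp
    rw [← hε'.isProduct.balanced _ _ _ (hv hp), DHBundle.ract, DHBundle.ract, v.map_act, v.ψ_eq]
  choose f hf using hex
  have hf' : ∀ {p n}, P.proj p = ℘ (𝒯.N.proj n) → f (ε p n) = ε' (v.toFun p) n :=
    fun h => (hf _ _ _ h rfl).symm
  have f_act : ∀ d q, f (K.Q.act d q) = K'.Q.act d (f q) := fun d q => by
    obtain ⟨p, n, hp, rfl⟩ := hε.exists_eq q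
    rw [← hε.map_act hp, hf' ((P.proj_act d p).trans hp), hf' hp, v.map_act,
      hε'.map_act (hv hp)]
  refine ⟨⟨⟨f, DHBundle.contMDiff_of_section f_act fun b => ?_, fun q => ?_, f_act, fun q => ?_⟩,
    fun q e h => ?_⟩, fun p n h => hf' h⟩
  · obtain ⟨V, hV, hb, n, hn, hn'⟩ := 𝒯.N.isLeft.exists_section b
    obtain ⟨V', hV', hb', p, hp, hp'⟩ := P.isPrincipal.exists_section (℘ b)
    have hV'' : ∀ y ∈ V ∩ ℘ ⁻¹' V', P.proj (p (℘ y)) = ℘ (𝒯.N.proj (n y)) := fun y hy => by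
      rw [hp' _ hy.2, hn' _ hy.1]
    have hpy := hp.comp h℘.contMDiffOn (s := V ∩ ℘ ⁻¹' V') fun y hy => hy.2
    refine ⟨V ∩ ℘ ⁻¹' V', hV.inter (hV'.preimage h℘.continuous), ⟨hb, hb'⟩,
      fun y => ε (p (℘ y)) (n y), fun y hy => ?_, fun y hy => ?_, ?_⟩
    · exact hε.isProduct.contMDiffWithinAt (hpy y hy) (hn.mono Set.inter_subset_left y hy) hy hV''
    · rw [hε.proj_eq (hV'' y hy), hn' y hy.1]
    · have h : ContMDiffOn 𝓘(ℝ, VY) (𝓘(ℝ, VY).prod 𝓘(ℝ, VD)) ∞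
          (fun y => ε' (v.toFun (p (℘ y))) (n y)) (V ∩ ℘ ⁻¹' V') := fun y hy =>
        hε'.isProduct.contMDiffWithinAt (v.smooth.comp_contMDiffOn hpy y hy)
          (hn.mono Set.inter_subset_left y hy) hy fun w hw => hv (hV'' w hw)
      exact h.congr fun y hy => hf' (hV'' y hy)
  · obtain ⟨p, n, hp, rfl⟩ := hε.exists_eq q
    rw [hf' hp, hε.proj_eq hp, hε'.proj_eq (hv hp)]
  · obtain ⟨p, n, hp, rfl⟩ := hε.exists_eq q
    rw [hf' hp, hε.ψ_eq hp, hε'.ψ_eq (hv hp), v.ψ_eq]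
  · obtain ⟨p, n, hp, rfl⟩ := hε.exists_eq q
    obtain ⟨n', -, hn, rfl⟩ := 𝒯.exists_β_eq (n := n) (e := e) (by rw [← h, hε.proj_eq hp])
    show f (K.z _ _) = K'.z (f _) _
    rw [hε.z_eq _ _ _ hp hn, hf' hp, hf' (hp.trans hn), hε'.z_eq _ _ _ (hv hp) hn]

/-- The comparison of a module with the twist of its descended bundle, `q ↦ [[q, n⁻¹], n]`. -/
theorem exists_unit {δ : K.Q.carrier → 𝒯.N.carrier → P.carrier} (hδ : IsDescent 𝒯 K P δ)
    {ε : P.carrier → 𝒯.N.carrier → K'.Q.carrier} (hε : IsTwist 𝒯 P K' ε) :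
    ∃ u : K ⟶ K', ∀ q n, K.Q.proj q = 𝒯.N.proj n → u.hom.toFun q = ε (δ q n) n := by
  have hN : ∀ q, ∃ n, K.Q.proj q = 𝒯.N.proj n := fun q =>
    (𝒯.N.isLeft.exists_proj_eq (Set.mem_univ (K.Q.proj q))).imp fun _ => Eq.symm
  -- Independence of n in its fibre: [[q, (k n)⁻¹], k n] = [[q, (k n)⁻¹] ◁ k, n] = [[q, n⁻¹], n].
  have hex : ∀ q, ∃ q', ∀ n, K.Q.proj q = 𝒯.N.proj n → q' = ε (δ q n) n := fun q => by
    obtain ⟨n', hn'⟩ := hN q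
    refine ⟨ε (δ q n') n', fun n hn => ?_⟩
    obtain ⟨k, rfl⟩ := 𝒯.N.isLeft.exists_act_eq (p := n) (q := n') (by rw [← hn, hn'])
    rw [𝒯.N.proj_lact] at hn
    have hq : K.Q.proj q = 𝒯.N.proj (𝒯.N.lact k n') := by rw [𝒯.N.proj_lact, hn]
    rw [← hε.isProduct.balanced _ _ _ ((hδ.proj_eq hq).trans (by rw [𝒯.N.proj_lact])),
      ← hδ.isProduct.ract_eq hq]
    show _ = ε (δ q (𝒯.N.lact k⁻¹ (𝒯.N.lact k n'))) n'
    rw [𝒯.N.isLeft.inv_act_act]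
  choose f hf using hex
  have f_act : ∀ d q, f (K.Q.act d q) = K'.Q.act d (f q) := fun d q => by
    obtain ⟨n, hn⟩ := hN q
    rw [hf _ n ((K.Q.proj_act d q).trans hn), hf q n hn, hδ.map_act hn, hε.map_act (hδ.proj_eq hn)]
  refine ⟨⟨⟨f, DHBundle.contMDiff_of_section f_act fun b => ?_, fun q => ?_, f_act, fun q => ?_⟩,
    fun q e h => ?_⟩, fun q n h => hf q n h⟩
  · obtain ⟨V, hV, hb, n, hn, hn'⟩ := 𝒯.N.isLeft.exists_section b
    obtain ⟨V', hV', hb', q, hq, hq'⟩ := K.Q.isPrincipal.exists_section b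
    have hqn : ∀ y ∈ V ∩ V', K.Q.proj (q y) = 𝒯.N.proj (n y) := fun y hy => by
      rw [hq' _ hy.2, hn' _ hy.1]
    refine ⟨V ∩ V', hV.inter hV', ⟨hb, hb'⟩, q, hq.mono Set.inter_subset_right,
      fun y hy => hq' y hy.2, ?_⟩
    have h : ContMDiffOn 𝓘(ℝ, VY) (𝓘(ℝ, VY).prod 𝓘(ℝ, VD)) ∞
        (fun y => ε (δ (q y) (n y)) (n y)) (V ∩ V') := fun y hy =>
      hε.isProduct.contMDiffWithinAt (hδ.isProduct.contMDiffWithinAt (a := n)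
        (hq.mono Set.inter_subset_right y hy) (hn.mono Set.inter_subset_left y hy) hy hqn)
        (hn.mono Set.inter_subset_left y hy) hy fun w hw => hδ.proj_eq (hqn w hw)
    exact h.congr fun y hy => hf _ _ (hqn y hy)
  · obtain ⟨n, hn⟩ := hN q
    rw [hf q n hn, hε.proj_eq (hδ.proj_eq hn), hn]
  · obtain ⟨n, hn⟩ := hN q
    rw [hf q n hn, hε.ψ_eq (hδ.proj_eq hn), hδ.ψ_eq hn, inv_mul_cancel_right]
  · obtain ⟨n, hn⟩ := hN q
    obtain ⟨n', -, hn', rfl⟩ := 𝒯.exists_β_eq (n := n) (e := e) (by rw [← h, hn])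
    show f (K.z _ _) = K'.z (f _) _
    rw [hf _ n' (K.proj_z_β hn hn'), hf q n hn, hδ.descent _ _ _ hn hn',
      hε.z_eq _ _ _ (hδ.proj_eq hn) hn']

/-- The comparison of a bundle with the bundle descended from its twist, `p ↦ [[p, n], n⁻¹]`. -/
theorem exists_counit (hε : IsTwist 𝒯 P K ε) {δ : K.Q.carrier → 𝒯.N.carrier → P'.carrier}
    (hδ : IsDescent 𝒯 K P' δ)
    (h_surj : Function.Surjective ℘) (h_subm : Manifold.IsSubmersion 𝓘(ℝ, VY) 𝓘(ℝ, VM) ∞ ℘) :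
    ∃ v : P ⟶ P', ∀ p n, P.proj p = ℘ (𝒯.N.proj n) → v.toFun p = δ (ε p n) n := by
  have hN : ∀ p, ∃ n, P.proj p = ℘ (𝒯.N.proj n) := fun p => by
    obtain ⟨y, hy⟩ := h_surj (P.proj p)
    obtain ⟨n, rfl⟩ := 𝒯.N.isLeft.exists_proj_eq (Set.mem_univ y)
    exact ⟨n, hy.symm⟩
  -- Here n ranges over all points of 𝓝 above one fibre of ℘, so independence uses descent:
  -- transport by β(n', n) sends [p, n'] to [p, n] and is invisible to δ.
  have hex : ∀ p, ∃ p', ∀ n, P.proj p = ℘ (𝒯.N.proj n) → p' = δ (ε p n) n := fun p => by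
    obtain ⟨n', hn'⟩ := hN p
    refine ⟨δ (ε p n') n', fun n hn => ?_⟩
    have h := hn'.symm.trans hn
    rw [← hδ.descent _ _ _ (hε.proj_eq hn') h, hε.z_eq _ _ _ hn' h]
  choose f hf using hex
  have f_act : ∀ d p, f (P.act d p) = P'.act d (f p) := fun d p => by
    obtain ⟨n, hn⟩ := hN p
    rw [hf _ n ((P.proj_act d p).trans hn), hf p n hn, hε.map_act hn, hδ.map_act (hε.proj_eq hn)]
  refine ⟨⟨f, DHBundle.contMDiff_of_section f_act fun b => ?_, fun p => ?_, f_act, fun p => ?_⟩,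
    fun p n h => hf p n h⟩
  · obtain ⟨U, hU, hb, n, -, hn, -, hn', -⟩ := 𝒯.exists_section h_surj h_subm K.Q b
    obtain ⟨V, hV, hb', p, hp, hp'⟩ := P.isPrincipal.exists_section b
    have hpn : ∀ x ∈ U ∩ V, P.proj (p x) = ℘ (𝒯.N.proj (n x)) := fun x hx => by
      rw [hp' _ hx.2, hn' _ hx.1]
    refine ⟨U ∩ V, hU.inter hV, ⟨hb, hb'⟩, p, hp.mono Set.inter_subset_right,
      fun x hx => hp' x hx.2, ?_⟩
    have h : ContMDiffOn 𝓘(ℝ, VM) (𝓘(ℝ, VM).prod 𝓘(ℝ, VD)) ∞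
        (fun x => δ (ε (p x) (n x)) (n x)) (U ∩ V) := fun x hx =>
      hδ.isProduct.contMDiffWithinAt (a := n) (hε.isProduct.contMDiffWithinAt
        (hp.mono Set.inter_subset_right x hx) (hn.mono Set.inter_subset_left x hx) hx hpn)
        (hn.mono Set.inter_subset_left x hx) hx fun w hw => hε.proj_eq (hpn w hw)
    exact h.congr fun x hx => hf _ _ (hpn x hx)
  · obtain ⟨n, hn⟩ := hN p
    rw [hf p n hn, hδ.proj_eq (hε.proj_eq hn), hn]
  · obtain ⟨n, hn⟩ := hN p
    rw [hf p n hn, hδ.ψ_eq (hε.proj_eq hn), hε.ψ_eq hn, mul_inv_cancel_right]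

end IsTwist

/-- Every morphism of modules is an isomorphism. -/
theorem GerbeModule.isIso [LieGroup 𝓘(ℝ, VD) ∞ D] {K K' : GerbeModule Ξ 𝒢} (u : K ⟶ K') :
    IsIso u := by
  have := DHBundle.isIso u.hom
  have h1 : ∀ q, u.hom.toFun ((inv u.hom).toFun q) = q := fun q =>
    congrArg (fun f : K'.Q ⟶ K'.Q => f.toFun q) (IsIso.inv_hom_id u.hom)
  have h2 : ∀ q, (inv u.hom).toFun (u.hom.toFun q) = q := fun q =>
    congrArg (fun f : K.Q ⟶ K.Q => f.toFun q) (IsIso.hom_inv_id u.hom)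
  let v : K' ⟶ K := ⟨inv u.hom, fun q e h => by
    have h' : K.Q.proj ((inv u.hom).toFun q) = (𝒢.E.proj e).1 := by
      rw [(inv u.hom).proj_eq, h]
    have h3 := u.z_eq _ e h'
    rw [h1] at h3
    rw [← h3, h2]⟩
  exact ⟨v, GerbeModule.hom_ext h2, GerbeModule.hom_ext h1⟩

end ModuleMorphisms

/-! ### The equivalence of categories -/

theorem mainTheorem5
    {VM : Type*} [NormedAddCommGroup VM] [NormedSpace ℝ VM] [FiniteDimensional ℝ VM]
    {VY : Type*} [NormedAddCommGroup VY] [NormedSpace ℝ VY] [FiniteDimensional ℝ VY]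
    {VH : Type*} [NormedAddCommGroup VH] [NormedSpace ℝ VH] [FiniteDimensional ℝ VH]
    {VD : Type*} [NormedAddCommGroup VD] [NormedSpace ℝ VD] [FiniteDimensional ℝ VD]
    {VE : Type*} [NormedAddCommGroup VE] [NormedSpace ℝ VE] [FiniteDimensional ℝ VE]
    {VN : Type*} [NormedAddCommGroup VN] [NormedSpace ℝ VN] [FiniteDimensional ℝ VN]
    {M : Type u} [TopologicalSpace M] [ChartedSpace VM M] [IsManifold 𝓘(ℝ, VM) ∞ M]
    {Y : Type u} [TopologicalSpace Y] [ChartedSpace VY Y] [IsManifold 𝓘(ℝ, VY) ∞ Y]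
    {H : Type u} [Group H] [TopologicalSpace H] [ChartedSpace VH H] [LieGroup 𝓘(ℝ, VH) ∞ H]
    {D : Type u} [Group D] [TopologicalSpace D] [ChartedSpace VD D] [LieGroup 𝓘(ℝ, VD) ∞ D]
    (X : LieCrossedModule VH VD H D)
    (℘ : Y → M) (h_surj : Function.Surjective ℘)
    (h_subm : Manifold.IsSubmersion 𝓘(ℝ, VY) 𝓘(ℝ, VM) ∞ ℘)
    (𝒢 : BundleGerbe VY ℘ VH H VE) (𝒯 : 𝒢.Trivialization VN) :
    ∃ e : GerbeModule X 𝒢 ≌ DHBundle X VM M,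
      (∃ δ : ∀ K : GerbeModule X 𝒢, K.Q.carrier → 𝒯.N.carrier → (e.functor.obj K).carrier,
        (∀ K, IsDescent 𝒯 K (e.functor.obj K) (δ K)) ∧
        ∀ (K K' : GerbeModule X 𝒢) (u : K ⟶ K') (q : K.Q.carrier) (n : 𝒯.N.carrier),
          K.Q.proj q = 𝒯.N.proj n →
            (e.functor.map u).toFun (δ K q n) = δ K' (u.hom.toFun q) n) ∧
      (∃ ε : ∀ P : DHBundle X VM M, P.carrier → 𝒯.N.carrier → (e.inverse.obj P).Q.carrier,
        (∀ P, IsTwist 𝒯 P (e.inverse.obj P) (ε P)) ∧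
        ∀ (P P' : DHBundle X VM M) (v : P ⟶ P') (p : P.carrier) (n : 𝒯.N.carrier),
          P.proj p = ℘ (𝒯.N.proj n) →
            (e.inverse.map v).hom.toFun (ε P p n) = ε P' (v.toFun p) n) := by
  have h℘ := h_subm.contMDiff
  -- The functors are chosen objectwise; the properties of δ and ε determine their values on
  -- morphisms.
  choose F δ hδ using fun K : GerbeModule X 𝒢 => K.exists_isDescent 𝒯 h_surj h_subm
  choose G ε hε using fun P : DHBundle X VM M => P.exists_isTwist 𝒯 h℘
  choose Fm hFm using fun (K K' : GerbeModule X 𝒢) (u : K ⟶ K') =>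
    (hδ K).exists_map (hδ K') h_surj h_subm u
  choose Gm hGm using fun (P P' : DHBundle X VM M) (v : P ⟶ P') =>
    (hε P).exists_map (hε P') h℘ v
  let Φ : GerbeModule X 𝒢 ⥤ DHBundle X VM M :=
    { obj := F
      map := fun {K K'} u => Fm K K' u
      map_id := fun K => (hδ K).hom_ext h_surj fun q n h => hFm K K (𝟙 K) q n h
      map_comp := fun {K K' K''} u v => (hδ K).hom_ext h_surj fun q n h => by
        refine (hFm K K'' (u ≫ v) q n h).trans ?_
        show _ = (Fm K' K'' v).toFun ((Fm K K' u).toFun (δ K q n))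
        rw [hFm K K' u q n h, hFm K' K'' v _ n ((u.hom.proj_eq q).trans h)]
        rfl }
  let Γ : DHBundle X VM M ⥤ GerbeModule X 𝒢 :=
    { obj := G
      map := fun {P P'} v => Gm P P' v
      map_id := fun P => (hε P).hom_ext fun p n h => hGm P P (𝟙 P) p n h
      map_comp := fun {P P' P''} v w => (hε P).hom_ext fun p n h => by
        refine (hGm P P'' (v ≫ w) p n h).trans ?_
        show _ = (Gm P' P'' w).hom.toFun ((Gm P P' v).hom.toFun (ε P p n))
        rw [hGm P P' v p n h, hGm P' P'' w _ n ((v.proj_eq p).trans h)]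
        rfl }
  choose η hη using fun K : GerbeModule X 𝒢 => IsTwist.exists_unit (hδ K) (hε (F K))
  choose θ hθ using fun P : DHBundle X VM M =>
    (hε P).exists_counit (hδ (G P)) h_surj h_subm
  let unit : 𝟭 _ ≅ Φ ⋙ Γ := NatIso.ofComponents (fun K => @asIso _ _ _ _ (η K)
    (GerbeModule.isIso (η K))) fun {K K'} u => by
    refine GerbeModule.hom_ext fun q => ?_
    obtain ⟨n, hn⟩ := 𝒯.N.isLeft.exists_proj_eq (Set.mem_univ (K.Q.proj q))
    show (η K').hom.toFun (u.hom.toFun q) = (Gm _ _ (Fm K K' u)).hom.toFun ((η K).hom.toFun q)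
    rw [hη K q n hn.symm, hη K' _ n ((u.hom.proj_eq q).trans hn.symm),
      hGm _ _ _ _ n ((hδ K).proj_eq hn.symm), hFm K K' u q n hn.symm]
  let counit : 𝟭 _ ≅ Γ ⋙ Φ := NatIso.ofComponents (fun P => @asIso _ _ _ _ (θ P)
    (DHBundle.isIso (θ P))) fun {P P'} v => by
    refine DHBundle.hom_ext fun p => ?_
    obtain ⟨y, hy⟩ := h_surj (P.proj p)
    obtain ⟨n, rfl⟩ := 𝒯.N.isLeft.exists_proj_eq (Set.mem_univ y)
    show (θ P').toFun (v.toFun p) = (Fm _ _ (Gm P P' v)).toFun ((θ P).toFun p)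
    rw [hθ P p n hy.symm, hθ P' _ n ((v.proj_eq p).trans hy.symm),
      hFm _ _ _ _ n ((hε P).proj_eq hy.symm), hGm P P' v p n hy.symm]
  -- `Equivalence.mk` may alter the unit to satisfy the triangle identities but keeps both functors,
  -- so the data δ and ε still apply. The comparison P → 𝓝-twist-and-descend points opposite to a
  -- counit, hence `symm`.
  exact ⟨CategoryTheory.Equivalence.mk Φ Γ unit counit.symm, ⟨δ, hδ, hFm⟩, ⟨ε, hε, hGm⟩⟩
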